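/- Let $R$ be a commutative ring and let $M$ be an $R$-module. An $\mathcal R$-module is a covariant functor $\mathbb M$ from commutative $R$-algebras to abelian groups together with an $R'$-module structure on each $\mathbb M(R')$, compatible with the maps $\mathbb M(R')\to\mathbb M(R'')$. Morphisms, submodules, kernels and direct limits (over non-empty upward directed index sets) of $\mathcal R$-modules are formed pointwise. Put $\mathcal R(R'):=R'$, $\mathcal R^n(R'):=R'^n$, $\mathcal M(R'):=M\otimes_R R'$, and, for an $\mathcal R$-module $\mathbb M$, let $\mathbb M^*$ be the $\mathcal R$-module $\mathbb M^*(R'):=\mathrm{Hom}_{\mathcal R'}(\mathbb M_{|R'},\mathcal R')$, where $\mathbb M_{|R'}$ is the restriction of $\mathbb M$ to commutative $R'$-algebras. $\mathbb M$ is reflexive if the canonical morphism $\mathbb M\to\mathbb M^{**}$ is an isomorphism. For an $R$-module $N$, $\mathcal N^*$ is called the module scheme associated with $N$; an $\mathcal R$-module is a module scheme associated with an $R$-module if it is isomorphic to $\mathcal N^*$ for some $R$-module $N$. An $\mathcal R$-module is an affine scheme if its underlying functor of sets is isomorphic to $R'\mapsto \mathrm{Hom}_{R\text{-alg}}(A,R')$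 for some commutative $R$-algebra $A$. An $\mathcal R$-submodule of $\mathcal M$ that is an affine scheme (resp. a module scheme associated with an $R$-module) is called a submodule affine scheme (resp. a submodule scheme associated with an $R$-module) of $\mathcal M$. Finally, $M$ is a flat Mittag-Leffler module if it is the direct limit of a direct system of free $R$-modules of finite rank $\{L_i\}$, over an upward directed set, such that for each $i$ there is $j\ge i$ with $\mathrm{Im}(L_k^*\to L_i^*)=\mathrm{Im}(L_j^*\to L_i^*)$ for all $k\ge j$. **Theorem.** The following statements are equivalent. 1. $M$ is a flat Mittag-Leffler module. 2. $\mathcal M$ is the direct limit of some directed family of submodule schemes associated with $R$-modules (with the inclusions as transition morphisms). 3. $\mathcal M=\varinjlim_i \mathcal N_i^*$ for some direct system $\{\mathcal N_i^*\}$, with $N_i$ $R$-modules, in which $\mathcal N_i^*\to\mathcal N_j^*$ is a monomorphism for all $i\le j$. 4. The set of all submodule schemes of $\mathcal M$ associated with $R$-modules is directed by inclusion, and $\mathcal M$ is its direct limit. 5. The set of all submodule affine schemes of $\mathcal M$ that are reflexive is directed by inclusion, and $\mathcal M$ is its direct limit. 6. The set of all submodule affine schemes of $\mathcal M$ is directed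 by inclusion, and $\mathcal M$ is its direct limit. 7. For every $R$-module $N$, every morphism $\mathcal N^*\to\mathcal M$ factors through a submodule scheme of $\mathcal M$ associated with an $R$-module. 8. For every $n\ge 0$, every morphism $\mathcal R^n\to\mathcal M$ factors through a submodule scheme of $\mathcal M$ associated with an $R$-module. 9. For every $R$-module $N$, the kernel of every morphism $\mathcal N^*\to\mathcal M$ is a module scheme associated with an $R$-module. 10. For every $n\ge 0$, the kernel of every morphism $\mathcal R^n\to\mathcal M$ is a module scheme associated with an $R$-module. 11. For every $R$-module $N$, the kernel of every morphism $\mathcal N^*\to\mathcal M$ is a reflexive $\mathcal R$-module affine scheme. 12. For every $n\ge 0$, the kernel of every morphism $\mathcal R^n\to\mathcal M$ is a reflexive $\mathcal R$-module affine scheme. -/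

import Mathlib

open scoped TensorProduct

universe u w w₁ w₂ w₃

/-- An `𝓡`-module, for a commutative ring `R`: a covariant functor `F` from commutative `R`-algebras
to abelian groups together with an `S`-module structure on `F(S)` for every commutative
`R`-algebra `S`, compatible with the maps of the functor. -/
structure ModuleFunctor (R : Type u) [CommRing R] where
  /-- the value at a commutative `R`-algebra -/
  obj : ∀ (S : Type u) [CommRing S] [Algebra R S], Type w
  /-- the values are abelian groups -/
  addCommGroup : ∀ (S : Type u) [CommRing S] [Algebra R S], AddCommGroup (obj S)
  /-- the value at `S` is an `S`-module -/
  module : ∀ (S : Type u) [CommRing S] [Algebra R S], Module S (obj S)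
  /-- functoriality -/
  map : ∀ {S T : Type u} [CommRing S] [Algebra R S] [CommRing T] [Algebra R T],
    (S →ₐ[R] T) → (obj S →+ obj T)
  map_smul : ∀ {S T : Type u} [CommRing S] [Algebra R S] [CommRing T] [Algebra R T]
    (f : S →ₐ[R] T) (s : S) (x : obj S), map f (s • x) = f s • map f x
  map_id : ∀ (S : Type u) [CommRing S] [Algebra R S] (x : obj S), map (AlgHom.id R S) x = x
  map_comp : ∀ {S T U : Type u} [CommRing S] [Algebra R S] [CommRing T] [Algebra R T]
    [CommRing U] [Algebra R U] (g : T →ₐ[R] U) (f : S →ₐ[R] T) (x : obj S),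
    map (g.comp f) x = map g (map f x)

namespace ModuleFunctor

attribute [instance] ModuleFunctor.addCommGroup ModuleFunctor.module

variable {R : Type u} [CommRing R]

/-- A morphism of `𝓡`-modules. -/
structure Hom (F : ModuleFunctor.{u, w₁} R) (G : ModuleFunctor.{u, w₂} R) where
  /-- the component at `S` -/
  app : ∀ (S : Type u) [CommRing S] [Algebra R S], F.obj S →ₗ[S] G.obj S
  naturality : ∀ {S T : Type u} [CommRing S] [Algebra R S] [CommRing T] [Algebra R T]
    (f : S →ₐ[R] T) (x : F.obj S), app T (F.map f x) = G.map f (app S x)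

/-- A morphism of `𝓡`-modules is a monomorphism if all its components are injective. -/
def Hom.IsMono {F : ModuleFunctor.{u, w₁} R} {G : ModuleFunctor.{u, w₂} R} (f : Hom F G) : Prop :=
  ∀ (S : Type u) [CommRing S] [Algebra R S], Function.Injective (f.app S)

/-- A morphism of `𝓡`-modules is an isomorphism if all its components are bijective. -/
def Hom.IsIso {F : ModuleFunctor.{u, w₁} R} {G : ModuleFunctor.{u, w₂} R} (f : Hom F G) : Prop :=
  ∀ (S : Type u) [CommRing S] [Algebra R S], Function.Bijective (f.app S)

/-! ### Basic examples -/

/-- The functor of rings `𝓡`, `𝓡(S) = S`, as a module over itself. -/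
abbrev ring (R : Type u) [CommRing R] : ModuleFunctor.{u, u} R where
  obj S _ _ := S
  addCommGroup _ _ _ := inferInstance
  module _ _ _ := inferInstance
  map f := (f : _ →+* _).toAddMonoidHom
  map_smul f s x := by simp
  map_id S _ _ x := rfl
  map_comp g f x := rfl

/-- The `𝓡`-module `𝓡ⁿ`, `𝓡ⁿ(S) = Sⁿ`. -/
abbrev ringPow (R : Type u) [CommRing R] (n : ℕ) : ModuleFunctor.{u, u} R where
  obj S _ _ := Fin n → S
  addCommGroup _ _ _ := inferInstance
  module _ _ _ := inferInstance
  map f := (f : _ →+* _).toAddMonoidHom.compLeft (Fin n)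
  map_smul f s x := by ext i; simp
  map_id S _ _ x := rfl
  map_comp g f x := rfl

/-- The quasi-coherent `𝓡`-module `𝓜` associated with an `R`-module `M`, `𝓜(S) = S ⊗[R] M`. -/
abbrev quasiCoherent (R : Type u) [CommRing R] (M : Type w) [AddCommGroup M] [Module R M] :
    ModuleFunctor.{u, max u w} R where
  obj S _ _ := S ⊗[R] M
  addCommGroup _ _ _ := inferInstance
  module _ _ _ := inferInstance
  map f := (TensorProduct.map f.toLinearMap (LinearMap.id : M →ₗ[R] M)).toAddMonoidHom
  map_smul f s x := by
    induction x using TensorProduct.induction_on with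
    | zero => simp
    | tmul a m => simp [TensorProduct.smul_tmul']
    | add x y hx hy => simp only [smul_add, _root_.map_add, hx, hy]
  map_id S _ _ x := by simp
  map_comp g f x := by
    induction x using TensorProduct.induction_on with
    | zero => simp
    | tmul a m => simp
    | add x y hx hy => simp only [_root_.map_add, hx, hy]

/-! ### Internal Hom, duals, reflexivity -/

/-- `Hom_{𝓢}(F|_S, G|_S)`: the morphisms between the restrictions of `F` and `G` to the category of
commutative `S`-algebras. A commutative `S`-algebra is given here as a commutative
`R`-algebra `T` with a morphism of `R`-algebras `S → T`. -/
@[ext]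
structure RestrictHom (F : ModuleFunctor.{u, w₁} R) (G : ModuleFunctor.{u, w₂} R)
    (S : Type u) [CommRing S] [Algebra R S] where
  /-- the component at the `S`-algebra `g : S → T` -/
  app : ∀ (T : Type u) [CommRing T] [Algebra R T], (S →ₐ[R] T) → (F.obj T →ₗ[T] G.obj T)
  naturality : ∀ {T U : Type u} [CommRing T] [Algebra R T] [CommRing U] [Algebra R U]
    (g : S →ₐ[R] T) (h : T →ₐ[R] U) (x : F.obj T),
    app U (h.comp g) (F.map h x) = G.map h (app T g x)

namespace RestrictHom

variable {F : ModuleFunctor.{u, w₁} R} {G : ModuleFunctor.{u, w₂} R}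
variable {S : Type u} [CommRing S] [Algebra R S]

instance : Zero (RestrictHom F G S) :=
  ⟨{ app := fun _ _ _ _ => 0, naturality := fun g h x => by simp }⟩

instance : Add (RestrictHom F G S) :=
  ⟨fun a b =>
    { app := fun T _ _ g => a.app T g + b.app T g
      naturality := fun g h x => by simp [a.naturality, b.naturality] }⟩

instance : Neg (RestrictHom F G S) :=
  ⟨fun a =>
    { app := fun T _ _ g => -a.app T g
      naturality := fun g h x => by simp [a.naturality] }⟩

instance : SMul S (RestrictHom F G S) :=
  ⟨fun s a =>
    { app := fun T _ _ g => g s • a.app T g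
      naturality := fun g h x => by simp [a.naturality, G.map_smul] }⟩

theorem zero_app (T : Type u) [CommRing T] [Algebra R T] (g : S →ₐ[R] T) :
    (0 : RestrictHom F G S).app T g = 0 := rfl

theorem add_app (a b : RestrictHom F G S) (T : Type u) [CommRing T] [Algebra R T]
    (g : S →ₐ[R] T) : (a + b).app T g = a.app T g + b.app T g := rfl

theorem neg_app (a : RestrictHom F G S) (T : Type u) [CommRing T] [Algebra R T]
    (g : S →ₐ[R] T) : (-a).app T g = -a.app T g := rfl

theorem smul_app (s : S) (a : RestrictHom F G S) (T : Type u) [CommRing T] [Algebra R T]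
    (g : S →ₐ[R] T) : (s • a).app T g = g s • a.app T g := rfl

theorem ext_app {a b : RestrictHom F G S}
    (h : ∀ (T : Type u) [CommRing T] [Algebra R T] (g : S →ₐ[R] T), a.app T g = b.app T g) :
    a = b := by
  apply RestrictHom.ext
  funext T _ _ g
  exact h T g

instance : AddCommGroup (RestrictHom F G S) where
  add_assoc a b c := ext_app fun T _ _ g => by simp only [add_app, add_assoc]
  zero_add a := ext_app fun T _ _ g => by simp only [add_app, zero_app, zero_add]
  add_zero a := ext_app fun T _ _ g => by simp only [add_app, zero_app, add_zero]
  add_comm a b := ext_app fun T _ _ g => by simp only [add_app, add_comm]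
  neg_add_cancel a := ext_app fun T _ _ g => by
    simp only [add_app, neg_app, zero_app, neg_add_cancel]
  nsmul := nsmulRec
  zsmul := zsmulRec

instance : Module S (RestrictHom F G S) where
  one_smul a := ext_app fun T _ _ g => by simp only [smul_app, map_one, one_smul]
  mul_smul r s a := ext_app fun T _ _ g => by simp only [smul_app, map_mul, mul_smul]
  smul_zero r := ext_app fun T _ _ g => by simp only [smul_app, zero_app, smul_zero]
  smul_add r a b := ext_app fun T _ _ g => by simp only [smul_app, add_app, smul_add]
  add_smul r s a := ext_app fun T _ _ g => by simp only [smul_app, add_app, _root_.map_add, add_smul]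
  zero_smul a := ext_app fun T _ _ g => by simp only [smul_app, zero_app, map_zero, zero_smul]

end RestrictHom

/-- The internal Hom of `𝓡`-modules, `S ↦ Hom_{𝓢}(F|_S, G|_S)`. -/
abbrev internalHom (F : ModuleFunctor.{u, w₁} R) (G : ModuleFunctor.{u, w₂} R) :
    ModuleFunctor.{u, max (u + 1) w₁ w₂} R where
  obj S _ _ := RestrictHom F G S
  addCommGroup _ _ _ := inferInstance
  module _ _ _ := inferInstance
  map f :=
    { toFun := fun a =>
        { app := fun T _ _ g => a.app T (g.comp f)
          naturality := fun g h x => a.naturality (g.comp f) h x }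
      map_zero' := rfl
      map_add' := fun _ _ => rfl }
  map_smul _ _ _ := rfl
  map_id _ _ _ _ := rfl
  map_comp _ _ _ := rfl

/-- The dual `F^* = 𝕙om(F, 𝓡)`. -/
abbrev dual (F : ModuleFunctor.{u, w} R) : ModuleFunctor.{u, max (u + 1) w} R :=
  internalHom F (ring R)

/-- The canonical morphism `F → F^**`, sending `x` to evaluation at `x`. -/
def toBidual (F : ModuleFunctor.{u, w} R) : Hom F F.dual.dual where
  app S _ _ :=
    { toFun := fun x =>
        { app := fun T _ _ g =>
            { toFun := fun φ => RestrictHom.app (F := F) (G := ring R) φ T (AlgHom.id R T) (F.map g x)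
              map_add' := fun _ _ => rfl
              map_smul' := fun _ _ => rfl }
          naturality := fun {T U} _ _ _ _ g h φ => by
            have := RestrictHom.naturality (F := F) (G := ring R) φ (AlgHom.id R T) h (F.map g x)
            rw [← F.map_comp] at this
            exact this }
      map_add' := fun x y => by
        refine RestrictHom.ext_app fun T _ _ g => LinearMap.ext fun φ => ?_
        change RestrictHom.app (F := F) (G := ring R) φ T (AlgHom.id R T) (F.map g (x + y)) =
          RestrictHom.app (F := F) (G := ring R) φ T (AlgHom.id R T) (F.map g x) +
          RestrictHom.app (F := F) (G := ring R) φ T (AlgHom.id R T) (F.map g y)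
        rw [_root_.map_add, _root_.map_add]
      map_smul' := fun s x => by
        refine RestrictHom.ext_app fun T _ _ g => LinearMap.ext fun φ => ?_
        change RestrictHom.app (F := F) (G := ring R) φ T (AlgHom.id R T) (F.map g (s • x)) =
          g s • RestrictHom.app (F := F) (G := ring R) φ T (AlgHom.id R T) (F.map g x)
        rw [F.map_smul, _root_.map_smul] }
  naturality {S T} _ _ _ _ f x := by
    refine RestrictHom.ext_app fun U _ _ g => LinearMap.ext fun φ => ?_
    change RestrictHom.app (F := F) (G := ring R) φ U (AlgHom.id R U) (F.map g (F.map f x)) =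
      RestrictHom.app (F := F) (G := ring R) φ U (AlgHom.id R U) (F.map (g.comp f) x)
    rw [F.map_comp]

/-- `F` is reflexive if the canonical morphism `F → F^**` is an isomorphism. -/
def IsReflexive (F : ModuleFunctor.{u, w} R) : Prop := F.toBidual.IsIso

/-! ### Module schemes -/

/-- The `𝓡`-module scheme `𝓝^*` associated with an `R`-module `N`. -/
abbrev schemeOf (R : Type u) [CommRing R] (N : Type u) [AddCommGroup N] [Module R N] :
    ModuleFunctor.{u, u + 1} R :=
  (quasiCoherent R N).dual

/-- `F` is an `𝓡`-module scheme associated with an `R`-module: `F ≅ 𝓦^*` for some `R`-module `W`. -/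
def IsAssociatedScheme (F : ModuleFunctor.{u, w} R) : Prop :=
  ∃ (W : Type u) (_ : AddCommGroup W) (_ : Module R W) (e : Hom (schemeOf R W) F), e.IsIso

/-- `F` is an `𝓡`-module affine scheme: as a functor of sets, it is the functor of points
`S ↦ Hom_R(Spec S, Spec A) = Hom_{R-alg}(A, S)` of an affine `R`-scheme `Spec A`. -/
def IsAffineScheme (F : ModuleFunctor.{u, w} R) : Prop :=
  ∃ (A : Type u) (_ : CommRing A) (_ : Algebra R A)
    (e : ∀ (S : Type u) [CommRing S] [Algebra R S], (A →ₐ[R] S) ≃ F.obj S),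
    ∀ (S T : Type u) [CommRing S] [Algebra R S] [CommRing T] [Algebra R T]
      (f : S →ₐ[R] T) (a : A →ₐ[R] S), e T (f.comp a) = F.map f (e S a)

/-! ### Submodules, kernels -/

/-- An `𝓡`-submodule of `F`. -/
@[ext]
structure Sub (F : ModuleFunctor.{u, w} R) where
  /-- the submodule of `F(S)` -/
  carrier : ∀ (S : Type u) [CommRing S] [Algebra R S], Submodule S (F.obj S)
  map_mem : ∀ {S T : Type u} [CommRing S] [Algebra R S] [CommRing T] [Algebra R T]
    (f : S →ₐ[R] T) {x : F.obj S}, x ∈ carrier S → F.map f x ∈ carrier T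

namespace Sub

variable {F : ModuleFunctor.{u, w} R}

/-- Inclusion of `𝓡`-submodules. -/
instance : PartialOrder (Sub F) where
  le V W := ∀ (S : Type u) [CommRing S] [Algebra R S], V.carrier S ≤ W.carrier S
  le_refl _ _ _ _ := le_rfl
  le_trans _ _ _ h h' S _ _ := (h S).trans (h' S)
  le_antisymm V W h h' := by
    apply Sub.ext
    funext S _ _
    exact le_antisymm (h S) (h' S)

/-- An `𝓡`-submodule, as an `𝓡`-module. -/
abbrev toFunctor (W : Sub F) : ModuleFunctor.{u, w} R where
  obj S _ _ := W.carrier S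
  addCommGroup _ _ _ := inferInstance
  module _ _ _ := inferInstance
  map f :=
    { toFun := fun x => ⟨F.map f x.1, W.map_mem f x.2⟩
      map_zero' := Subtype.ext (_root_.map_zero (F.map f))
      map_add' := fun x y => Subtype.ext (_root_.map_add (F.map f) x.1 y.1) }
  map_smul f s x := Subtype.ext (F.map_smul f s x.1)
  map_id S _ _ x := Subtype.ext (F.map_id S x.1)
  map_comp g f x := Subtype.ext (F.map_comp g f x.1)

/-- The inclusion morphism of an `𝓡`-submodule. -/
def incl (W : Sub F) : Hom W.toFunctor F where
  app S _ _ := (W.carrier S).subtype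
  naturality _ _ := rfl

/-- The inclusion morphism between two `𝓡`-submodules, one contained in the other. -/
def inclusion {V W : Sub F} (h : V ≤ W) : Hom V.toFunctor W.toFunctor where
  app S _ _ := Submodule.inclusion (h S)
  naturality _ _ := rfl

end Sub

/-- The kernel of a morphism of `𝓡`-modules, `(Ker f)(S) = Ker (f_S)`. -/
def Hom.ker {F : ModuleFunctor.{u, w₁} R} {G : ModuleFunctor.{u, w₂} R} (f : Hom F G) : Sub F where
  carrier S _ _ := LinearMap.ker (f.app S)
  map_mem g x hx := by
    rw [LinearMap.mem_ker] at hx ⊢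
    rw [f.naturality, hx, _root_.map_zero]

/-- The morphism `f : F → G` factors through the `𝓡`-submodule `W` of `G`. -/
def Hom.FactorsThrough {F : ModuleFunctor.{u, w₁} R} {G : ModuleFunctor.{u, w₂} R} (f : Hom F G)
    (W : Sub G) : Prop :=
  ∃ g : Hom F W.toFunctor, ∀ (S : Type u) [CommRing S] [Algebra R S] (x : F.obj S),
    W.incl.app S (g.app S x) = f.app S x

/-! ### Direct limits -/

/-- `G`, with the morphisms `c i : F i → G`, is the direct limit of the direct system of
`𝓡`-modules `F i`, `t i j : F i → F j`, indexed by an upward directed set: for every `S`, the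
induced morphism from the direct limit of the `S`-modules `F i (S)` to `G(S)` is an isomorphism. -/
structure IsDirectLimit {ι : Type w₃} [Preorder ι] (F : ι → ModuleFunctor.{u, w₁} R)
    (t : ∀ i j, i ≤ j → Hom (F i) (F j)) (G : ModuleFunctor.{u, w₂} R)
    (c : ∀ i, Hom (F i) G) : Prop where
  nonempty : Nonempty ι
  directed : IsDirectedOrder ι
  system : ∀ (S : Type u) [CommRing S] [Algebra R S],
    DirectedSystem (fun i => (F i).obj S) (fun i j h => (t i j h).app S)
  compatible : ∀ (S : Type u) [CommRing S] [Algebra R S] (i j : ι) (h : i ≤ j) (x : (F i).obj S),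
    (c j).app S ((t i j h).app S x) = (c i).app S x
  bijective : ∀ (S : Type u) [CommRing S] [Algebra R S] [DecidableEq ι],
    Function.Bijective (Module.DirectLimit.lift S ι (fun i => (F i).obj S)
      (fun i j h => (t i j h).app S) (fun i => (c i).app S) (compatible S))

/-- `F` is the direct limit of the directed family of its `𝓡`-submodules `W i`, with the inclusions
as transition morphisms. -/
def IsDirectLimitOfSubs (F : ModuleFunctor.{u, w} R) {ι : Type w₃} [Preorder ι] (W : ι → Sub F)
    (hW : Monotone W) : Prop :=
  IsDirectLimit (fun i => (W i).toFunctor) (fun _ _ h => Sub.inclusion (hW h)) F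
    (fun i => (W i).incl)

/-- `F` is the direct limit of all its `𝓡`-submodules with the property `P`, ordered by inclusion
(in particular these form a directed set). -/
def IsDirectLimitOfAllSubs (F : ModuleFunctor.{u, w} R) (P : Sub F → Prop) : Prop :=
  F.IsDirectLimitOfSubs (fun W : {W : Sub F // P W} => W.1) (fun _ _ h => h)

end ModuleFunctor

/-- `M` is a flat Mittag-Leffler module: it is the direct limit of a direct system of free modules
of finite rank `L i` such that the inverse system of the duals `(L i)^*` satisfies the
Mittag-Leffler condition. -/
def IsFlatMittagLeffler (R : Type u) [CommRing R] (M : Type u) [AddCommGroup M] [Module R M] :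
    Prop :=
  ∃ (ι : Type u) (_ : Preorder ι) (_ : DecidableEq ι) (_ : Nonempty ι) (_ : IsDirectedOrder ι)
    (L : ι → Type u) (_ : ∀ i, AddCommGroup (L i)) (_ : ∀ i, Module R (L i))
    (t : ∀ i j, i ≤ j → L i →ₗ[R] L j),
    DirectedSystem L (fun i j h => t i j h) ∧
    (∀ i, Module.Free R (L i) ∧ Module.Finite R (L i)) ∧
    (∀ i, ∃ (j : ι) (hij : i ≤ j), ∀ (k : ι) (hjk : j ≤ k),
      LinearMap.range (t i k (hij.trans hjk)).dualMap = LinearMap.range (t i j hij).dualMap) ∧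
    Nonempty (Module.DirectLimit L t ≃ₗ[R] M)

/-! A morphism 𝓝^* → 𝓜 is given by a finite sum ∑ nₐ ⊗ mₐ in N ⊗ M (`Hom.exists_sum`, by evaluation
on a square zero extension). It therefore involves only finitely many elements of M, and every
condition reduces to one on finite families x₁, …, xₙ in M.

The pivot is the kernel of 𝓡ⁿ → 𝓜, s ↦ ∑ sₐ ⊗ xₐ. If it is a module scheme, the relations between
the coordinates of its universal point form a submodule N of Rⁿ (`exists_isCoeffModule`): the
smallest one for which ∑ eₐ ⊗ xₐ comes from N ⊗ M, and the kernel is its annihilator. When all these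
kernels are module schemes, three things follow. The equational criterion makes M flat. Minimality
of N makes the induced 𝓝^* → 𝓜 a monomorphism, so the xₐ lie in a submodule scheme
(`exists_subschemeData`). Writing M as a direct limit of finite free Lᵢ and taking for the xₐ the
image of a basis of Lᵢ, the submodule N of Lᵢ^* ≅ Rⁿ is the stable image of the Lⱼ^*, which is the
Mittag-Leffler condition (`isFlatMittagLeffler_of_directedSystem`). Conversely, under that condition
the stable image supplies the linear equations of the kernel (`ker_powHom_of_isFlatMittagLeffler`).

Submodule schemes containing finite families give back the kernels, because a morphism 𝓡ⁿ → 𝓦^* is a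
family of linear equations indexed by W. They also make 𝓜 a direct limit
(`isDirectLimitOfSubs_quasiCoherent`).

Affine schemes enter through the tangent space at the origin. As S[ε] ⊗ M = (S ⊗ M) ⊕ ε(S ⊗ M), the
tangent space of an affine submodule of 𝓜 is again a submodule of 𝓜. It contains the given one, and
it is a module scheme because it consists of derivations (`Sub.isAssociatedScheme_tangent`). A
reflexive 𝓡-module is its own tangent space, so "reflexive and affine" means "associated with a
module" (`isAssociatedScheme_iff_reflexive_affine`). -/

namespace ModuleFunctor

variable {R : Type u} [CommRing R]

/-! ### Morphisms -/

namespace Hom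

variable {F : ModuleFunctor.{u, w₁} R} {G : ModuleFunctor.{u, w₂} R} {H : ModuleFunctor.{u, w₃} R}

/-- Composition of morphisms of `𝓡`-modules. -/
def comp (g : Hom G H) (f : Hom F G) : Hom F H where
  app S _ _ := g.app S ∘ₗ f.app S
  naturality h x := by simp [f.naturality, g.naturality]

@[simp] theorem comp_app (g : Hom G H) (f : Hom F G) (S : Type u) [CommRing S] [Algebra R S]
    (x : F.obj S) : (g.comp f).app S x = g.app S (f.app S x) := rfl

/-- The inverse of an isomorphism of `𝓡`-modules. -/
noncomputable def inv (f : Hom F G) (hf : f.IsIso) : Hom G F where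
  app S _ _ := (LinearEquiv.ofBijective (f.app S) (hf S)).symm
  naturality {S T} _ _ _ _ h x := by
    apply (hf T).1
    rw [f.naturality]
    have h₁ := (LinearEquiv.ofBijective (f.app T) (hf T)).apply_symm_apply (G.map h x)
    have h₂ := (LinearEquiv.ofBijective (f.app S) (hf S)).apply_symm_apply x
    rw [LinearEquiv.ofBijective_apply] at h₁ h₂
    exact h₁.trans (congrArg _ h₂.symm)

@[simp] theorem app_inv (f : Hom F G) (hf : f.IsIso) (S : Type u) [CommRing S] [Algebra R S]
    (x : G.obj S) : f.app S ((f.inv hf).app S x) = x :=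
  (LinearEquiv.ofBijective (f.app S) (hf S)).apply_symm_apply x

@[simp] theorem inv_app (f : Hom F G) (hf : f.IsIso) (S : Type u) [CommRing S] [Algebra R S]
    (x : F.obj S) : (f.inv hf).app S (f.app S x) = x :=
  (LinearEquiv.ofBijective (f.app S) (hf S)).symm_apply_apply x

theorem isIso_inv (f : Hom F G) (hf : f.IsIso) : (f.inv hf).IsIso := fun S _ _ =>
  (LinearEquiv.ofBijective (f.app S) (hf S)).symm.bijective

theorem IsIso.comp {g : Hom G H} {f : Hom F G} (hg : g.IsIso) (hf : f.IsIso) :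
    (g.comp f).IsIso := fun S _ _ => (hg S).comp (hf S)

/-- The image of a morphism of `𝓡`-modules. -/
def range (f : Hom F G) : Sub G where
  carrier S _ _ := LinearMap.range (f.app S)
  map_mem := by
    rintro S T _ _ _ _ h _ ⟨x, rfl⟩
    exact ⟨F.map h x, f.naturality h x⟩

/-- A morphism of `𝓡`-modules as a morphism to its image. -/
def rangeRestrict (f : Hom F G) : Hom F f.range.toFunctor where
  app S _ _ := (f.app S).rangeRestrict
  naturality h x := Subtype.ext (f.naturality h x)

theorem IsMono.isIso_rangeRestrict {f : Hom F G} (hf : f.IsMono) : f.rangeRestrict.IsIso :=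
  fun S _ _ => ⟨fun _ _ h => hf S (congrArg Subtype.val h), (f.app S).surjective_rangeRestrict⟩

theorem factorsThrough_iff {f : Hom F G} {W : Sub G} : f.FactorsThrough W ↔
    ∀ (S : Type u) [CommRing S] [Algebra R S] (x : F.obj S), f.app S x ∈ W.carrier S := by
  constructor
  · rintro ⟨g, hg⟩ S _ _ x
    rw [← hg S x]
    exact (g.app S x).2
  · intro h
    exact ⟨{ app := fun S _ _ => (f.app S).codRestrict (W.carrier S) (h S)
             naturality := fun g x => Subtype.ext (f.naturality g x) }, fun _ _ _ _ => rfl⟩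

end Hom

/-! ### The functor `S ↦ Hom_R(N, S)` -/

/-- The `𝓡`-module `S ↦ Hom_R(N, S)`. -/
abbrev homFunctor (R : Type u) [CommRing R] (N : Type u) [AddCommGroup N] [Module R N] :
    ModuleFunctor.{u, u} R where
  obj S _ _ := N →ₗ[R] S
  addCommGroup _ _ _ := inferInstance
  module _ _ _ := inferInstance
  map f :=
    { toFun := fun x => f.toLinearMap ∘ₗ x
      map_zero' := by ext; simp
      map_add' := fun x y => by ext; simp }
  map_smul f s x := by ext; simp
  map_id S _ _ x := rfl
  map_comp g f x := rfl

section homFunctor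

variable (N : Type u) [AddCommGroup N] [Module R N]

/-- The morphism `𝓝^* → Hom_R(N, -)`. -/
noncomputable def schemeOfToHomFunctor : Hom (schemeOf R N) (homFunctor R N) where
  app S _ _ :=
    { toFun := fun φ =>
        (RestrictHom.app (F := quasiCoherent R N) (G := ring R) φ S (AlgHom.id R S)).restrictScalars R
          ∘ₗ TensorProduct.mk R S N 1
      map_add' := fun _ _ => rfl
      map_smul' := fun _ _ => rfl }
  naturality {S T} _ _ _ _ f φ := by
    refine LinearMap.ext fun n => ?_
    have := RestrictHom.naturality (F := quasiCoherent R N) (G := ring R) φ (AlgHom.id R S) f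
      ((1 : S) ⊗ₜ[R] n)
    change RestrictHom.app (F := quasiCoherent R N) (G := ring R) φ T f ((1 : T) ⊗ₜ[R] n) =
      f (RestrictHom.app (F := quasiCoherent R N) (G := ring R) φ S (AlgHom.id R S) ((1 : S) ⊗ₜ[R] n))
    simpa using this

/-- A T-linear form on T ⊗ N is fixed by its values on 1 ⊗ n, and naturality along S → T fixes these
from the values over S. Every linear map N → S extends by base change. -/
theorem isIso_schemeOfToHomFunctor : (schemeOfToHomFunctor (R := R) N).IsIso := by
  intro S _ _
  constructor
  · intro φ ψ h
    refine RestrictHom.ext_app fun T _ _ g => ?_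
    refine TensorProduct.AlgebraTensorModule.curry_injective (LinearMap.ext_ring ?_)
    refine LinearMap.ext fun n => ?_
    have h₁ := RestrictHom.naturality (F := quasiCoherent R N) (G := ring R) φ (AlgHom.id R S) g
      ((1 : S) ⊗ₜ[R] n)
    have h₂ := RestrictHom.naturality (F := quasiCoherent R N) (G := ring R) ψ (AlgHom.id R S) g
      ((1 : S) ⊗ₜ[R] n)
    have h₃ := LinearMap.congr_fun h n
    change RestrictHom.app (F := quasiCoherent R N) (G := ring R) φ S (AlgHom.id R S) ((1 : S) ⊗ₜ[R] n)
      = RestrictHom.app (F := quasiCoherent R N) (G := ring R) ψ S (AlgHom.id R S) ((1 : S) ⊗ₜ[R] n)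
      at h₃
    rw [h₃, ← h₂] at h₁
    simpa using h₁
  · intro x
    refine ⟨{ app := fun T _ _ g => LinearMap.liftBaseChange T (g.toLinearMap ∘ₗ x)
              naturality := fun {T U} _ _ _ _ g h y => ?_ }, ?_⟩
    · induction y using TensorProduct.induction_on with
      | zero => simp
      | tmul a m => simp
      | add y z hy hz => simp only [_root_.map_add, hy, hz]
    · refine LinearMap.ext fun n => ?_
      change LinearMap.liftBaseChange S ((AlgHom.id R S).toLinearMap ∘ₗ x) ((1 : S) ⊗ₜ[R] n) = x n
      simp

end homFunctor

theorem isAssociatedScheme_iff {F : ModuleFunctor.{u, w} R} : F.IsAssociatedScheme ↔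
    ∃ (W : Type u) (_ : AddCommGroup W) (_ : Module R W) (e : Hom (homFunctor R W) F), e.IsIso := by
  constructor
  · rintro ⟨W, _, _, e, he⟩
    exact ⟨W, _, _, e.comp ((schemeOfToHomFunctor W).inv (isIso_schemeOfToHomFunctor W)),
      he.comp (Hom.isIso_inv _ _)⟩
  · rintro ⟨W, _, _, e, he⟩
    exact ⟨W, _, _, e.comp (schemeOfToHomFunctor W), he.comp (isIso_schemeOfToHomFunctor W)⟩

theorem isAssociatedScheme_of_isIso {F : ModuleFunctor.{u, w} R} {W : Type u} [AddCommGroup W]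
    [Module R W] (e : Hom F (homFunctor R W)) (he : e.IsIso) : F.IsAssociatedScheme :=
  isAssociatedScheme_iff.2 ⟨W, _, _, e.inv he, e.isIso_inv he⟩

theorem IsAssociatedScheme.of_isIso {F : ModuleFunctor.{u, w₁} R} {G : ModuleFunctor.{u, w₂} R}
    (hF : F.IsAssociatedScheme) (f : Hom F G) (hf : f.IsIso) : G.IsAssociatedScheme := by
  obtain ⟨W, _, _, e, he⟩ := hF
  exact ⟨W, _, _, f.comp e, hf.comp he⟩

/-! ### Square zero extensions -/

section SquareZero

variable (R)
variable (S T : Type u) [CommRing S] [Algebra R S] [CommRing T] [Algebra R T]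

/-- The square zero extension of `S` by the base change to `S` of an `R`-module `N`. -/
abbrev sqZero (N : Type u) [AddCommGroup N] [Module R N] : Type u := TrivSqZeroExt S (S ⊗[R] N)

/-- The ring of dual numbers `S[ε]`. -/
abbrev dualNum : Type u := TrivSqZeroExt S S

/-- The inclusion of `S` in `S[ε]`. -/
abbrev dualInl : S →ₐ[R] dualNum S := TrivSqZeroExt.inlAlgHom R S S

/-- The projection `S[ε] → S`, `ε ↦ 0`. -/
abbrev dualFst : dualNum S →ₐ[R] S := TrivSqZeroExt.fstHom R S S

/-- The `ε`-component `S[ε] → S`. -/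
def dualSnd : dualNum S →ₗ[R] S := (TrivSqZeroExt.sndHom S S).restrictScalars R

variable {S T}

@[simp] theorem dualSnd_apply (x : dualNum S) : dualSnd R S x = x.snd := rfl

variable {R}
variable {N : Type u} [AddCommGroup N] [Module R N]

/-- The morphism of algebras from the square zero extension of `S` by `N` to `T[ε]` given by
morphisms `S → T` and `N → T`. -/
def sqZeroMap (g : S →ₐ[R] T) (x : N →ₗ[R] T) : sqZero R S N →ₐ[R] dualNum T :=
  TrivSqZeroExt.lift ((dualInl R T).comp g)
    ((TrivSqZeroExt.inrHom T T).restrictScalars R ∘ₗ LinearMap.mul' R T ∘ₗ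
      TensorProduct.map g.toLinearMap x)
    (fun _ _ => by simp)
    (fun s y => by
      induction y using TensorProduct.induction_on with
      | zero => simp
      | tmul a m =>
        ext
        · simp
        · simp [TensorProduct.smul_tmul']
          ring
      | add y z hy hz => simp only [smul_add, _root_.map_add, hy, hz, mul_add])
    (fun s y => by
      induction y using TensorProduct.induction_on with
      | zero => simp
      | tmul a m =>
        ext
        · simp
        · simp [TensorProduct.smul_tmul']
          ring
      | add y z hy hz => simp only [smul_add, _root_.map_add, hy, hz, add_mul])

theorem sqZeroMap_fst (g : S →ₐ[R] T) (x : N →ₗ[R] T) (y : sqZero R S N) :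
    (sqZeroMap g x y).fst = g y.fst := by
  simp [sqZeroMap, TrivSqZeroExt.lift_def]

theorem sqZeroMap_snd (g : S →ₐ[R] T) (x : N →ₗ[R] T) (y : sqZero R S N) :
    (sqZeroMap g x y).snd = LinearMap.mul' R T (TensorProduct.map g.toLinearMap x y.snd) := by
  simp [sqZeroMap, TrivSqZeroExt.lift_def]

variable (R S N) in
/-- The inclusion of `N` in the square zero extension of `S` by `N`. -/
def sqZeroInr : N →ₗ[R] sqZero R S N :=
  (TrivSqZeroExt.inrHom S (S ⊗[R] N)).restrictScalars R ∘ₗ TensorProduct.mk R S N 1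

theorem sqZeroInr_apply (n : N) : sqZeroInr R S N n = TrivSqZeroExt.inr ((1 : S) ⊗ₜ[R] n) := rfl

variable (R S N) in
/-- The projection of the square zero extension of `S` by `N` to the base change of `N`. -/
def sqZeroSnd : sqZero R S N →ₗ[R] S ⊗[R] N :=
  (TrivSqZeroExt.sndHom S (S ⊗[R] N)).restrictScalars R

@[simp] theorem sqZeroSnd_apply (x : sqZero R S N) : sqZeroSnd R S N x = x.snd := rfl

/-- Taking the ε-component undoes z ↦ εz. This is what recovers the value of a morphism at x from
its value at εx. -/
theorem dualSnd_eps_smul {M : Type w} [AddCommGroup M] [Module R M] (z : S ⊗[R] M) :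
    TensorProduct.map (dualSnd R S) LinearMap.id
      ((TrivSqZeroExt.inr 1 : dualNum S) • (quasiCoherent R M).map (dualInl R S) z) = z := by
  change TensorProduct.map (dualSnd R S) LinearMap.id
      ((TrivSqZeroExt.inr 1 : dualNum S) • TensorProduct.map (dualInl R S).toLinearMap .id z) = z
  induction z using TensorProduct.induction_on with
  | zero => simp
  | tmul a m => simp [TensorProduct.smul_tmul']
  | add y z hy hz => simp only [smul_add, _root_.map_add, hy, hz]

theorem exists_sum_tmul_tmul {M : Type w} [AddCommGroup M] [Module R M]
    (z : (S ⊗[R] N) ⊗[R] M) : ∃ (k : ℕ) (s : Fin k → S) (n : Fin k → N) (m : Fin k → M),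
      z = ∑ a, (s a ⊗ₜ[R] n a) ⊗ₜ[R] m a := by
  have hadd : ∀ x y : (S ⊗[R] N) ⊗[R] M,
      (∃ (k : ℕ) (s : Fin k → S) (n : Fin k → N) (m : Fin k → M),
        x = ∑ a, (s a ⊗ₜ[R] n a) ⊗ₜ[R] m a) →
      (∃ (k : ℕ) (s : Fin k → S) (n : Fin k → N) (m : Fin k → M),
        y = ∑ a, (s a ⊗ₜ[R] n a) ⊗ₜ[R] m a) →
      (∃ (k : ℕ) (s : Fin k → S) (n : Fin k → N) (m : Fin k → M),
        x + y = ∑ a, (s a ⊗ₜ[R] n a) ⊗ₜ[R] m a) := by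
    rintro _ _ ⟨k, s, n, m, rfl⟩ ⟨k', s', n', m', rfl⟩
    exact ⟨k + k', Fin.append s s', Fin.append n n', Fin.append m m', by simp [Fin.sum_univ_add]⟩
  induction z using TensorProduct.induction_on with
  | zero => exact ⟨0, Fin.elim0, Fin.elim0, Fin.elim0, by simp⟩
  | add x y hx hy => exact hadd x y hx hy
  | tmul y m =>
    induction y using TensorProduct.induction_on with
    | zero => exact ⟨0, Fin.elim0, Fin.elim0, Fin.elim0, by simp⟩
    | add x y hx hy => rw [TensorProduct.add_tmul]; exact hadd _ _ hx hy
    | tmul s n => exact ⟨1, fun _ => s, fun _ => n, fun _ => m, by simp⟩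

end SquareZero

/-! ### Morphisms from a module scheme to a quasi-coherent module -/

section

variable {S : Type u} [CommRing S] [Algebra R S]
variable {N : Type u} [AddCommGroup N] [Module R N] {M : Type w} [AddCommGroup M] [Module R M]

/-- The inclusion of N in S ⊕ (S ⊗ N) is a universal point. For x : N → T, the algebra map to T[ε]
induced by g and x sends this point to εx, and linearity gives φ(εx) = εφ(x). The ε-component of the
image of φ(universal point) is thus φ(x), and only the (S ⊗ N) ⊗ M component of that value matters.
-/
theorem RestrictHom.exists_sum (φ : RestrictHom (homFunctor R N) (quasiCoherent R M) S) :
    ∃ (k : ℕ) (s : Fin k → S) (n : Fin k → N) (m : Fin k → M),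
      ∀ (T : Type u) [CommRing T] [Algebra R T] (g : S →ₐ[R] T) (x : N →ₗ[R] T),
        φ.app T g x = ∑ a, (g (s a) * x (n a)) ⊗ₜ[R] m a := by
  let i : S →ₐ[R] sqZero R S N := TrivSqZeroExt.inlAlgHom R S (S ⊗[R] N)
  let z : sqZero R S N ⊗[R] M := φ.app (sqZero R S N) i (sqZeroInr R S N)
  obtain ⟨k, s, n, m, hz⟩ := exists_sum_tmul_tmul
    (TensorProduct.map (sqZeroSnd R S N) LinearMap.id z)
  refine ⟨k, s, n, m, fun T _ _ g x => ?_⟩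
  have h₁ := φ.naturality i (sqZeroMap g x) (sqZeroInr R S N)
  have h₂ := φ.naturality g (dualInl R T) x
  have e₁ : (sqZeroMap g x).comp i = (dualInl R T).comp g := by
    ext a
    · simp [sqZeroMap_fst, i]
    · simp [sqZeroMap_snd, i]
  have e₂ : (homFunctor R N).map (sqZeroMap g x) (sqZeroInr R S N) =
      (TrivSqZeroExt.inr 1 : dualNum T) • (homFunctor R N).map (dualInl R T) x := by
    refine LinearMap.ext fun a => ?_
    change sqZeroMap g x (sqZeroInr R S N a) = (TrivSqZeroExt.inr 1 : dualNum T) * dualInl R T (x a)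
    ext
    · simp [sqZeroMap_fst, sqZeroInr_apply]
    · simp [sqZeroMap_snd, sqZeroInr_apply]
  -- `h₁` now computes εφ(x) from the universal value `z`; its ε-component gives φ(x) itself.
  rw [e₁, e₂, _root_.map_smul, h₂] at h₁
  have h₃ := congrArg (TensorProduct.map (dualSnd R T) (LinearMap.id : M →ₗ[R] M)) h₁
  rw [dualSnd_eps_smul] at h₃
  rw [h₃]
  have e₃ : ∀ y : sqZero R S N ⊗[R] M, TensorProduct.map (dualSnd R T) (LinearMap.id : M →ₗ[R] M)
      (TensorProduct.map (sqZeroMap g x).toLinearMap LinearMap.id y) =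
      TensorProduct.map (LinearMap.mul' R T ∘ₗ TensorProduct.map g.toLinearMap x) LinearMap.id
        (TensorProduct.map (sqZeroSnd R S N) LinearMap.id y) := by
    intro y
    induction y using TensorProduct.induction_on with
    | zero => simp
    | tmul a m => simp [sqZeroMap_snd]
    | add y z hy hz => simp only [_root_.map_add, hy, hz]
  refine (e₃ z).trans ?_
  rw [hz]
  simp

/-- A morphism of `𝓡`-modules as a morphism between the restrictions to `S`-algebras. -/
def Hom.restrict {F : ModuleFunctor.{u, w₁} R} {G : ModuleFunctor.{u, w₂} R} (f : Hom F G)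
    (S : Type u) [CommRing S] [Algebra R S] : RestrictHom F G S where
  app T _ _ _ := f.app T
  naturality _ h x := f.naturality h x

/-- The case S = R, with the scalars absorbed into M. A morphism from a module scheme to 𝓜 is
controlled by the finitely many mₐ. -/
theorem Hom.exists_sum (f : Hom (homFunctor R N) (quasiCoherent R M)) :
    ∃ (k : ℕ) (n : Fin k → N) (m : Fin k → M),
      ∀ (T : Type u) [CommRing T] [Algebra R T] (x : N →ₗ[R] T),
        f.app T x = ∑ a, x (n a) ⊗ₜ[R] m a := by
  obtain ⟨k, s, n, m, h⟩ := (f.restrict R).exists_sum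
  refine ⟨k, n, fun a => s a • m a, fun T _ _ x => ?_⟩
  rw [show f.app T x = (f.restrict R).app T (Algebra.ofId R T) x from rfl, h]
  refine Finset.sum_congr rfl fun a _ => ?_
  rw [← TensorProduct.smul_tmul, Algebra.smul_def, Algebra.ofId_apply]

/-- The case M = R: linear forms on Hom_R(N, -) over S come from S ⊗ N. -/
theorem RestrictHom.exists_sum_ring (φ : RestrictHom (homFunctor R N) (ring R) S) :
    ∃ (k : ℕ) (s : Fin k → S) (n : Fin k → N),
      ∀ (T : Type u) [CommRing T] [Algebra R T] (g : S →ₐ[R] T) (x : N →ₗ[R] T),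
        φ.app T g x = ∑ a, g (s a) * x (n a) := by
  let ψ : RestrictHom (homFunctor R N) (quasiCoherent R R) S :=
    { app := fun T _ _ g => (TensorProduct.AlgebraTensorModule.rid R T T).symm.toLinearMap ∘ₗ
        φ.app T g
      naturality := fun {T U} _ _ _ _ g h x => by
        have := φ.naturality g h x
        simp only [LinearMap.comp_apply]
        rw [this]
        simp }
  obtain ⟨k, s, n, m, h⟩ := ψ.exists_sum
  refine ⟨k, fun a => m a • s a, n, fun T _ _ g x => ?_⟩
  have := congrArg (TensorProduct.AlgebraTensorModule.rid R T T) (h T g x)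
  have e : TensorProduct.AlgebraTensorModule.rid R T T (ψ.app T g x) = φ.app T g x := by
    simp [ψ]
  rw [e] at this
  simpa using this

end

/-! ### Module schemes associated with modules are affine and reflexive -/

/-- Linear maps W → S are algebra morphisms from the symmetric algebra of W. -/
theorem IsAssociatedScheme.isAffineScheme {F : ModuleFunctor.{u, w} R}
    (hF : F.IsAssociatedScheme) : F.IsAffineScheme := by
  obtain ⟨W, _, _, e, he⟩ := isAssociatedScheme_iff.1 hF
  refine ⟨SymmetricAlgebra R W, inferInstance, inferInstance, fun S _ _ =>
    SymmetricAlgebra.lift.symm.trans (Equiv.ofBijective _ (he S)), fun S T _ _ _ _ f a => ?_⟩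
  exact e.naturality f (a.toLinearMap ∘ₗ SymmetricAlgebra.ι R W)

/-- Precomposition with a morphism of `𝓡`-modules. -/
def RestrictHom.precomp {F : ModuleFunctor.{u, w₁} R} {G : ModuleFunctor.{u, w₂} R}
    {H : ModuleFunctor.{u, w₃} R} {S : Type u} [CommRing S] [Algebra R S]
    (φ : RestrictHom G H S) (f : Hom F G) : RestrictHom F H S where
  app T _ _ g := φ.app T g ∘ₗ f.app T
  naturality g h x := by
    rw [LinearMap.comp_apply, f.naturality, φ.naturality]
    rfl

section

variable {F : ModuleFunctor.{u, w} R} {W : Type u} [AddCommGroup W] [Module R W]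

/-- Evaluation at `n`, as a linear form on an `𝓡`-module with a morphism to `Hom_R(W, -)`. -/
def evalForm (e : Hom F (homFunctor R W)) (n : W) (S : Type u) [CommRing S] [Algebra R S] :
    RestrictHom F (ring R) S where
  app T _ _ _ := LinearMap.applyₗ' T n ∘ₗ e.app T
  naturality g h x := by
    change e.app _ (F.map h x) n = h (e.app _ x n)
    rw [e.naturality]
    rfl

theorem evalForm_app (e : Hom F (homFunctor R W)) (n : W) (S : Type u) [CommRing S] [Algebra R S]
    (T : Type u) [CommRing T] [Algebra R T] (g : S →ₐ[R] T) (x : F.obj T) :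
    (evalForm e n S).app T g x = e.app T x n := rfl

theorem exists_eq_sum_evalForm (e : Hom F (homFunctor R W)) (he : e.IsIso)
    {S : Type u} [CommRing S] [Algebra R S] (φ : RestrictHom F (ring R) S) :
    ∃ (k : ℕ) (s : Fin k → S) (n : Fin k → W), φ = ∑ a, s a • evalForm e (n a) S := by
  obtain ⟨k, s, n, h⟩ := (φ.precomp (e.inv he)).exists_sum_ring
  refine ⟨k, s, n, RestrictHom.ext_app fun T _ _ g => LinearMap.ext fun x => ?_⟩
  have h₁ := h T g (e.app T x)
  change φ.app T g ((e.inv he).app T (e.app T x)) = _ at h₁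
  rw [Hom.inv_app] at h₁
  rw [h₁]
  let ev : RestrictHom F (ring R) S →+ T :=
    { toFun := fun ψ => ψ.app T g x
      map_zero' := rfl
      map_add' := fun _ _ => rfl }
  exact (map_sum ev (fun a => s a • evalForm e (n a) S) Finset.univ).symm

theorem toBidual_app_app {S : Type u} [CommRing S] [Algebra R S] (x : F.obj S)
    (T : Type u) [CommRing T] [Algebra R T] (g : S →ₐ[R] T) (φ : RestrictHom F (ring R) T) :
    RestrictHom.app (F := F.dual) (G := ring R) (F.toBidual.app S x) T g φ =
      φ.app T (AlgHom.id R T) (F.map g x) := rfl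

end

/-- The forms on F are combinations of evaluations at elements n of W, so a point Φ of the bidual is
determined by n ↦ Φ(evaluation at n). This is a linear map W → S, that is, a point of F. -/
theorem IsAssociatedScheme.isReflexive {F : ModuleFunctor.{u, w} R}
    (hF : F.IsAssociatedScheme) : F.IsReflexive := by
  obtain ⟨W, _, _, e', he'⟩ := isAssociatedScheme_iff.1 hF
  obtain ⟨e, he⟩ : ∃ e : Hom F (homFunctor R W), e.IsIso := ⟨e'.inv he', e'.isIso_inv he'⟩
  intro S _ _
  constructor
  · intro x y h
    apply (he S).1
    refine LinearMap.ext fun n => ?_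
    have h₁ := congrArg (fun Φ : RestrictHom F.dual (ring R) S =>
      Φ.app S (AlgHom.id R S) (evalForm e n S)) h
    change (evalForm e n S).app S (AlgHom.id R S) (F.map (AlgHom.id R S) x) =
      (evalForm e n S).app S (AlgHom.id R S) (F.map (AlgHom.id R S) y) at h₁
    rwa [F.map_id, F.map_id] at h₁
  · intro Φ
    change RestrictHom F.dual (ring R) S at Φ
    let x : W →ₗ[R] S :=
      { toFun := fun n => Φ.app S (AlgHom.id R S) (evalForm e n S)
        map_add' := fun m n => by
          rw [← _root_.map_add]
          congr 1
          refine RestrictHom.ext_app fun T _ _ g => LinearMap.ext fun y => ?_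
          exact _root_.map_add (e.app T y) m n
        map_smul' := fun r n => by
          rw [RingHom.id_apply, Algebra.smul_def, ← smul_eq_mul, ← _root_.map_smul]
          congr 1
          refine RestrictHom.ext_app fun T _ _ g => LinearMap.ext fun y => ?_
          refine (_root_.map_smul (e.app T y) r n).trans ?_
          rw [RestrictHom.smul_app, AlgHom.commutes, Algebra.smul_def]
          rfl }
    obtain ⟨y, hy⟩ := (he S).2 x
    refine ⟨y, RestrictHom.ext_app fun T _ _ g => LinearMap.ext fun φ => ?_⟩
    change RestrictHom F (ring R) T at φ
    obtain ⟨k, s, n, hφ⟩ := exists_eq_sum_evalForm e he φ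
    rw [hφ, map_sum, map_sum]
    refine Finset.sum_congr rfl fun a _ => ?_
    rw [_root_.map_smul, _root_.map_smul]
    congr 1
    rw [toBidual_app_app, evalForm_app, e.naturality, hy]
    have := Φ.naturality (AlgHom.id R S) g (evalForm e (n a) S)
    exact this.symm

/-! ### Dual numbers -/

/-- `F` identifies with its tangent space at the origin, `y ↦ ε • y`. -/
def IsTangentSelf (F : ModuleFunctor.{u, w} R) : Prop :=
  ∀ (S : Type u) [CommRing S] [Algebra R S],
    (∀ y : F.obj S, (TrivSqZeroExt.inr 1 : dualNum S) • F.map (dualInl R S) y = 0 → y = 0) ∧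
    ∀ x : F.obj (dualNum S), F.map (dualFst R S) x = 0 →
      ∃ y : F.obj S, (TrivSqZeroExt.inr 1 : dualNum S) • F.map (dualInl R S) y = x

/-- This is the decomposition S[ε] ⊗ M = (S ⊗ M) ⊕ ε(S ⊗ M), written out as the identity `key`. -/
theorem isTangentSelf_quasiCoherent (M : Type w) [AddCommGroup M] [Module R M] :
    (quasiCoherent R M).IsTangentSelf := by
  intro S _ _
  constructor
  · intro y hy
    rw [← dualSnd_eps_smul y, hy, _root_.map_zero]
  · intro x hx
    refine ⟨TensorProduct.map (dualSnd R S) LinearMap.id x, ?_⟩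
    have key : ∀ x : dualNum S ⊗[R] M, (quasiCoherent R M).map (dualInl R S)
        ((quasiCoherent R M).map (dualFst R S) x) + (TrivSqZeroExt.inr 1 : dualNum S) •
        (quasiCoherent R M).map (dualInl R S) (TensorProduct.map (dualSnd R S) LinearMap.id x) =
        x := by
      intro x
      change TensorProduct.map (dualInl R S).toLinearMap LinearMap.id
        (TensorProduct.map (dualFst R S).toLinearMap LinearMap.id x) +
        (TrivSqZeroExt.inr 1 : dualNum S) • TensorProduct.map (dualInl R S).toLinearMap LinearMap.id
          (TensorProduct.map (dualSnd R S) LinearMap.id x) = x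
      induction x using TensorProduct.induction_on with
      | zero => simp
      | tmul a m =>
        simp only [TensorProduct.map_tmul, TensorProduct.smul_tmul', ← TensorProduct.add_tmul]
        congr 1
        ext <;> simp
      | add y z hy hz =>
        nth_rw 3 [← hy, ← hz]
        simp only [_root_.map_add, smul_add]
        abel
    have := key x
    rwa [hx, _root_.map_zero, zero_add] at this

/-- The morphism `S[ε] → T[ε]` induced by a morphism `S → T`. -/
def dualMap {S T : Type u} [CommRing S] [Algebra R S] [CommRing T] [Algebra R T] (g : S →ₐ[R] T) :
    dualNum S →ₐ[R] dualNum T :=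
  TrivSqZeroExt.lift ((dualInl R T).comp g)
    ((TrivSqZeroExt.inrHom T T).restrictScalars R ∘ₗ g.toLinearMap)
    (fun _ _ => by simp)
    (fun s y => by
      ext
      · simp
      · simp
        exact mul_comm _ _)
    (fun s y => by ext <;> simp)

section dualMap

variable {S T : Type u} [CommRing S] [Algebra R S] [CommRing T] [Algebra R T]

@[simp] theorem dualMap_fst (g : S →ₐ[R] T) (x : dualNum S) : (dualMap g x).fst = g x.fst := by
  simp [dualMap, TrivSqZeroExt.lift_def]

@[simp] theorem dualMap_snd (g : S →ₐ[R] T) (x : dualNum S) : (dualMap g x).snd = g x.snd := by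
  simp [dualMap, TrivSqZeroExt.lift_def]

theorem dualMap_comp_inl (g : S →ₐ[R] T) :
    (dualMap g).comp (dualInl R S) = (dualInl R T).comp g := by
  ext <;> simp

theorem fst_comp_dualMap (g : S →ₐ[R] T) :
    (dualFst R T).comp (dualMap g) = g.comp (dualFst R S) := by
  ext <;> simp

theorem map_eps_smul (F : ModuleFunctor.{u, w} R) (g : S →ₐ[R] T) (y : F.obj S) :
    F.map (dualMap g) ((TrivSqZeroExt.inr 1 : dualNum S) • F.map (dualInl R S) y) =
      (TrivSqZeroExt.inr 1 : dualNum T) • F.map (dualInl R T) (F.map g y) := by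
  rw [F.map_smul, ← F.map_comp, dualMap_comp_inl, F.map_comp]
  congr 1
  ext <;> simp

theorem map_fst_eps_smul (F : ModuleFunctor.{u, w} R) (y : F.obj S) :
    F.map (dualFst R S) ((TrivSqZeroExt.inr 1 : dualNum S) • F.map (dualInl R S) y) = 0 := by
  rw [F.map_smul]
  simp

/-- The morphism of `R`-algebras `S[ε] → T` extending `f : S → T` with `ε ↦ a`, where `a² = 0`. -/
def dualLift (f : S →ₐ[R] T) (a : T) (ha : a * a = 0) : dualNum S →ₐ[R] T :=
  TrivSqZeroExt.lift f (LinearMap.mulRight R a ∘ₗ f.toLinearMap)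
    (fun x y => by
      change f x * a * (f y * a) = 0
      rw [mul_mul_mul_comm, ha, mul_zero])
    (fun s y => by simp [mul_assoc]) (fun s y => by simp [mul_comm, mul_left_comm])

theorem dualLift_apply (f : S →ₐ[R] T) (a : T) (ha : a * a = 0) (x : dualNum S) :
    dualLift f a ha x = f x.fst + f x.snd * a := by
  rfl

end dualMap

/-- Forms separate points, and φ(εy) = εφ(y), so εy = 0 forces y = 0. For x above 0, the rule φ ↦
(ε-component of φ(x)) is a point of the bidual, hence evaluation at some y; then εy and x agree on
all forms. -/
theorem IsReflexive.isTangentSelf {F : ModuleFunctor.{u, w} R} (hF : F.IsReflexive) :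
    F.IsTangentSelf := by
  intro S _ _
  constructor
  · intro y hy
    apply (hF S).1
    refine RestrictHom.ext_app fun T _ _ g => LinearMap.ext fun φ => ?_
    change RestrictHom F (ring R) T at φ
    have h₁ := φ.naturality (AlgHom.id R T) (dualInl R T) (F.map g y)
    have h₂ : (TrivSqZeroExt.inr 1 : dualNum T) • F.map (dualInl R T) (F.map g y) = 0 := by
      rw [← map_eps_smul, hy, _root_.map_zero]
    have h₃ := congrArg (φ.app (dualNum T) ((dualInl R T).comp (AlgHom.id R T))) h₂
    rw [_root_.map_smul, h₁, _root_.map_zero] at h₃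
    have h₄ := congrArg TrivSqZeroExt.snd h₃
    rw [toBidual_app_app, _root_.map_zero]
    change φ.app T (AlgHom.id R T) (F.map g y) = 0
    simpa using h₄
  · intro x hx
    let Φ : RestrictHom F.dual (ring R) S :=
      { app := fun T _ _ g =>
          { toFun := fun φ => (RestrictHom.app (F := F) (G := ring R) φ (dualNum T) (dualInl R T)
              (F.map (dualMap g) x)).snd
            map_add' := fun _ _ => rfl
            map_smul' := fun t φ => by
              change (dualInl R T t * RestrictHom.app (F := F) (G := ring R) φ (dualNum T)
                (dualInl R T) (F.map (dualMap g) x)).snd = _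
              simp }
        naturality := fun {T U} _ _ _ _ g h φ => by
          have h₁ := RestrictHom.naturality (F := F) (G := ring R) φ (dualInl R T) (dualMap h)
            (F.map (dualMap g) x)
          have h₂ : (dualMap h).comp (dualMap g) = dualMap (h.comp g) := by ext <;> simp
          rw [← F.map_comp, dualMap_comp_inl, h₂] at h₁
          change (RestrictHom.app (F := F) (G := ring R) φ (dualNum U) ((dualInl R U).comp h)
            (F.map (dualMap (h.comp g)) x)).snd = h (RestrictHom.app (F := F) (G := ring R) φ
              (dualNum T) (dualInl R T) (F.map (dualMap g) x)).snd
          rw [h₁]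
          exact dualMap_snd h _ }
    obtain ⟨y, hy⟩ := (hF S).2 Φ
    refine ⟨y, (hF _).1 ?_⟩
    refine RestrictHom.ext_app fun T _ _ g => LinearMap.ext fun φ => ?_
    change RestrictHom F (ring R) T at φ
    rw [toBidual_app_app, toBidual_app_app, F.map_smul, _root_.map_smul, ← F.map_comp]
    have h₁ := congrArg (fun Ψ : RestrictHom F.dual (ring R) S =>
      Ψ.app T (g.comp (dualInl R S)) φ) hy
    change φ.app T (AlgHom.id R T) (F.map (g.comp (dualInl R S)) y) =
      (φ.app (dualNum T) (dualInl R T) (F.map (dualMap (g.comp (dualInl R S))) x)).snd at h₁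
    rw [h₁]
    set z := F.map (dualMap (g.comp (dualInl R S))) x with hz
    have hε : g (TrivSqZeroExt.inr 1) * g (TrivSqZeroExt.inr 1) = 0 := by
      rw [← _root_.map_mul, TrivSqZeroExt.inr_mul_inr, _root_.map_zero]
    -- Any g : S[ε] → T factors as S[ε] → T[ε] → T, the first map induced by g restricted to S and
    -- the second, `q`, sending ε to g(ε). This expresses the value of φ on g(x) through its value
    -- over T[ε], whose constant term vanishes.
    let q := dualLift (AlgHom.id R T) (g (TrivSqZeroExt.inr 1)) hε
    have h₂ : q.comp (dualMap (g.comp (dualInl R S))) = g := by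
      refine AlgHom.ext fun a => ?_
      rw [AlgHom.comp_apply, dualLift_apply]
      simp only [dualMap_fst, dualMap_snd, AlgHom.comp_apply, AlgHom.id_apply]
      rw [← _root_.map_mul, ← _root_.map_add]
      congr 1
      ext <;> simp
    have h₃ := φ.naturality (dualInl R T) q z
    have h₄ : q.comp (dualInl R T) = AlgHom.id R T := by
      refine AlgHom.ext fun a => ?_
      rw [AlgHom.comp_apply, dualLift_apply]
      simp
    rw [h₄, hz, ← F.map_comp, h₂, ← hz] at h₃
    rw [h₃]
    have h₅ := φ.naturality (dualInl R T) (dualFst R T) z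
    have h₆ : (dualFst R T).comp (dualInl R T) = AlgHom.id R T := by ext; simp
    have h₇ : F.map (dualFst R T) z = 0 := by
      rw [hz, ← F.map_comp, fst_comp_dualMap, F.map_comp, hx, _root_.map_zero]
    rw [h₆, h₇, _root_.map_zero] at h₅
    change _ = q (φ.app (dualNum T) (dualInl R T) z)
    rw [dualLift_apply]
    change 0 = (φ.app (dualNum T) (dualInl R T) z).fst at h₅
    rw [← h₅]
    simp [mul_comm]

/-! ### The tangent space at the origin of an affine submodule -/

/-- The tangent space at the origin of a submodule `F` of `G`: the `y` with `ε • y ∈ F(S[ε])`. -/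
def Sub.tangent {G : ModuleFunctor.{u, w} R} (F : Sub G) : Sub G where
  carrier S _ _ :=
    { carrier := {y | (TrivSqZeroExt.inr 1 : dualNum S) • G.map (dualInl R S) y ∈
        F.carrier (dualNum S)}
      add_mem' := fun {x y} hx hy => by
        rw [Set.mem_ofPred_eq] at hx hy ⊢
        rw [_root_.map_add, smul_add]
        exact add_mem hx hy
      zero_mem' := by simp
      smul_mem' := fun s y hy => by
        rw [Set.mem_ofPred_eq] at hy ⊢
        rw [G.map_smul, smul_comm]
        exact Submodule.smul_mem _ _ hy }
  map_mem {S T} _ _ _ _ f y hy := by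
    change (TrivSqZeroExt.inr 1 : dualNum T) • G.map (dualInl R T) (G.map f y) ∈ F.carrier (dualNum T)
    rw [← map_eps_smul]
    exact F.map_mem _ hy

theorem Sub.le_tangent {G : ModuleFunctor.{u, w} R} (F : Sub G) : F ≤ F.tangent :=
  fun _ _ _ _ hy => Submodule.smul_mem _ _ (F.map_mem _ hy)

/-- The functoriality of the square zero extensions of `S`. -/
def extMap {S : Type u} [CommRing S] [Algebra R S] {P Q : Type u} [AddCommGroup P] [Module S P]
    [Module Sᵐᵒᵖ P] [IsCentralScalar S P] [Module R P] [IsScalarTower R S P]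
    [IsScalarTower R Sᵐᵒᵖ P] [AddCommGroup Q] [Module S Q]
    [Module Sᵐᵒᵖ Q] [IsCentralScalar S Q] [Module R Q] [IsScalarTower R S Q]
    [IsScalarTower R Sᵐᵒᵖ Q] (f : P →ₗ[S] Q) :
    TrivSqZeroExt S P →ₐ[R] TrivSqZeroExt S Q :=
  { (TrivSqZeroExt.map f).toRingHom with
    commutes' := fun r => by
      change TrivSqZeroExt.map f (algebraMap R (TrivSqZeroExt S P) r) = _
      ext <;> simp [TrivSqZeroExt.algebraMap_eq_inl'] }

section tangent

variable {G : ModuleFunctor.{u, w} R} {F : Sub G} {A : Type u} [CommRing A] [Algebra R A]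

/-- The submodule of `A` on which the derivations of `A` at the point `o` vanish. -/
def cotangentRel (o : A →ₐ[R] R) : Submodule R A :=
  Submodule.span R ({1} ∪ {z | ∃ x y, o x = 0 ∧ o y = 0 ∧ z = x * y})

/-- The linear forms on this quotient are the derivations of `A` at the point `o`. -/
abbrev cotangentAt (o : A →ₐ[R] R) : Type u := A ⧸ cotangentRel o

theorem cotangentAt_mk_one (o : A →ₐ[R] R) :
    (Submodule.Quotient.mk 1 : cotangentAt o) = 0 :=
  (Submodule.Quotient.mk_eq_zero _).2 (Submodule.subset_span (Or.inl rfl))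

/-- The Leibniz rule at o, from the vanishing of the class of (a - o(a))(b - o(b)). -/
theorem cotangentAt_mk_mul (o : A →ₐ[R] R) (a b : A) :
    (Submodule.Quotient.mk (a * b) : cotangentAt o) =
      o a • Submodule.Quotient.mk b + o b • Submodule.Quotient.mk a := by
  have h : (Submodule.Quotient.mk ((a - algebraMap R A (o a)) * (b - algebraMap R A (o b))) :
      cotangentAt o) = 0 :=
    (Submodule.Quotient.mk_eq_zero _).2 (Submodule.subset_span
      (Or.inr ⟨_, _, by simp, by simp, rfl⟩))
  have e : (a - algebraMap R A (o a)) * (b - algebraMap R A (o b)) =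
      a * b - (o a • b + o b • a) + (o a * o b) • (1 : A) := by
    simp only [Algebra.smul_def, _root_.map_mul]
    ring
  rw [e, Submodule.Quotient.mk_add, Submodule.Quotient.mk_smul, cotangentAt_mk_one, smul_zero,
    add_zero, Submodule.Quotient.mk_sub, sub_eq_zero] at h
  exact h

/-- The algebra morphism `A → S[ε]` given by a derivation at the point `o`. -/
def algHomOfForm (o : A →ₐ[R] R) {S : Type u} [CommRing S] [Algebra R S]
    (D : cotangentAt o →ₗ[R] S) : A →ₐ[R] dualNum S where
  toFun a := TrivSqZeroExt.inl (algebraMap R S (o a)) +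
    TrivSqZeroExt.inr (D (Submodule.Quotient.mk a))
  map_one' := by
    rw [cotangentAt_mk_one]
    ext <;> simp
  map_mul' a b := by
    rw [cotangentAt_mk_mul, _root_.map_add, _root_.map_smul, _root_.map_smul, Algebra.smul_def,
      Algebra.smul_def]
    ext
    · simp
    · simp [mul_comm]
  map_zero' := by
    rw [Submodule.Quotient.mk_zero]
    ext <;> simp
  map_add' a b := by
    rw [Submodule.Quotient.mk_add]
    ext <;> simp
  commutes' r := by
    rw [Algebra.algebraMap_eq_smul_one (A := A), Submodule.Quotient.mk_smul, cotangentAt_mk_one]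
    ext <;> simp [Algebra.algebraMap_eq_smul_one]

theorem algHomOfForm_fst (o : A →ₐ[R] R) {S : Type u} [CommRing S] [Algebra R S]
    (D : cotangentAt o →ₗ[R] S) (a : A) : (algHomOfForm o D a).fst = algebraMap R S (o a) := by
  simp [algHomOfForm]

theorem algHomOfForm_snd (o : A →ₐ[R] R) {S : Type u} [CommRing S] [Algebra R S]
    (D : cotangentAt o →ₗ[R] S) (a : A) :
    (algHomOfForm o D a).snd = D (Submodule.Quotient.mk a) := by
  simp [algHomOfForm]

variable (e : ∀ (S : Type u) [CommRing S] [Algebra R S], (A →ₐ[R] S) ≃ F.toFunctor.obj S)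

/-- The point `ε • y` of `F`, for `y` in the tangent space. -/
def tangentVec {S : Type u} [CommRing S] [Algebra R S] (y : F.tangent.carrier S) :
    F.toFunctor.obj (dualNum S) :=
  ⟨(TrivSqZeroExt.inr 1 : dualNum S) • G.map (dualInl R S) y, y.2⟩

theorem tangentVec_add {S : Type u} [CommRing S] [Algebra R S] (x y : F.tangent.carrier S) :
    tangentVec (x + y) = tangentVec x + tangentVec y := by
  refine Subtype.ext ?_
  change _ • G.map _ (x.1 + y.1) = _ • G.map _ x.1 + _ • G.map _ y.1
  rw [_root_.map_add, smul_add]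

/-- Scaling a tangent vector by s is functoriality along the endomorphism ε ↦ sε of S[ε]; this form
is visible on algebra morphisms out of A. -/
theorem tangentVec_smul {S : Type u} [CommRing S] [Algebra R S] (s : S)
    (y : F.tangent.carrier S) : tangentVec (s • y) =
      F.toFunctor.map (extMap (s • LinearMap.id)) (tangentVec y) := by
  refine Subtype.ext ?_
  change _ • G.map _ (s • y.1) = G.map _ (_ • G.map _ y.1)
  rw [G.map_smul, G.map_smul, ← G.map_comp, smul_smul]
  have h : (extMap (R := R) (s • LinearMap.id : S →ₗ[S] S)).comp (dualInl R S) = dualInl R S := by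
    ext <;> simp [extMap]
  rw [h]
  congr 1
  ext <;> simp [extMap]

theorem map_fst_tangentVec {S : Type u} [CommRing S] [Algebra R S] (y : F.tangent.carrier S) :
    F.toFunctor.map (dualFst R S) (tangentVec y) = 0 :=
  Subtype.ext (map_fst_eps_smul G y.1)

theorem map_tangentVec {S T : Type u} [CommRing S] [Algebra R S] [CommRing T] [Algebra R T]
    (f : S →ₐ[R] T) (y : F.tangent.carrier S) :
    tangentVec (F.tangent.toFunctor.map f y) = F.toFunctor.map (dualMap f) (tangentVec y) :=
  Subtype.ext (map_eps_smul G f y.1).symm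

theorem tangentVec_injective (hG : G.IsTangentSelf) {S : Type u} [CommRing S] [Algebra R S] :
    Function.Injective (tangentVec (F := F) (S := S)) := by
  intro x y h
  have h₁ : (TrivSqZeroExt.inr 1 : dualNum S) • G.map (dualInl R S) (x.1 - y.1) = 0 := by
    rw [_root_.map_sub, smul_sub, sub_eq_zero]
    exact congrArg Subtype.val h
  exact Subtype.ext (sub_eq_zero.1 ((hG S).1 _ h₁))

theorem exists_tangentVec (hG : G.IsTangentSelf) {S : Type u} [CommRing S] [Algebra R S]
    (x : F.toFunctor.obj (dualNum S)) (hx : F.toFunctor.map (dualFst R S) x = 0) :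
    ∃ y : F.tangent.carrier S, tangentVec y = x := by
  obtain ⟨y, hy⟩ := (hG S).2 x.1 (congrArg Subtype.val hx)
  refine ⟨⟨y, ?_⟩, Subtype.ext hy⟩
  change (TrivSqZeroExt.inr 1 : dualNum S) • G.map (dualInl R S) y ∈ F.carrier (dualNum S)
  rw [hy]
  exact x.2

variable (he : ∀ (S T : Type u) [CommRing S] [Algebra R S] [CommRing T] [Algebra R T]
      (f : S →ₐ[R] T) (a : A →ₐ[R] S), e T (f.comp a) = F.toFunctor.map f (e S a))

include he

theorem symm_map {S T : Type u} [CommRing S] [Algebra R S] [CommRing T] [Algebra R T]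
    (f : S →ₐ[R] T) (x : F.toFunctor.obj S) :
    (e T).symm (F.toFunctor.map f x) = f.comp ((e S).symm x) := by
  rw [Equiv.symm_apply_eq, he, Equiv.apply_symm_apply]

theorem symm_zero (S : Type u) [CommRing S] [Algebra R S] :
    (e S).symm 0 = (Algebra.ofId R S).comp ((e R).symm 0) := by
  rw [← _root_.map_zero (F.toFunctor.map (Algebra.ofId R S)), symm_map e he]

theorem symm_tangentVec_fst {S : Type u} [CommRing S] [Algebra R S] (y : F.tangent.carrier S)
    (a : A) : ((e _).symm (tangentVec y) a).fst = algebraMap R S ((e R).symm 0 a) := by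
  have h := symm_map e he (dualFst R S) (tangentVec y)
  rw [map_fst_tangentVec, symm_zero e he] at h
  exact (DFunLike.congr_fun h a).symm

/-- The addition of F is not known in terms of A, so both vectors are placed in one point over the
square zero extension S ⊕ (S × S). Its images under the two projections and under their sum are x, y
and x + y, and for an algebra morphism the ε-component along the sum is the sum of the components.
-/
theorem symm_tangentVec_add_snd {S : Type u} [CommRing S] [Algebra R S]
    (x y : F.tangent.carrier S) (a : A) : ((e _).symm (tangentVec (x + y)) a).snd =
      ((e _).symm (tangentVec x) a).snd + ((e _).symm (tangentVec y) a).snd := by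
  -- The point ε₁x + ε₂y.
  let z : F.toFunctor.obj (TrivSqZeroExt S (S × S)) :=
    F.toFunctor.map (extMap (LinearMap.inl S S S)) (tangentVec x) +
      F.toFunctor.map (extMap (LinearMap.inr S S S)) (tangentVec y)
  have c : ∀ (f : S × S →ₗ[S] S) (g : S →ₗ[S] S × S) (x : F.toFunctor.obj (dualNum S)),
      F.toFunctor.map (extMap f) (F.toFunctor.map (extMap g) x) =
        F.toFunctor.map (extMap (f ∘ₗ g)) x := by
    intro f g x
    rw [← F.toFunctor.map_comp]
    congr 2
    refine AlgHom.ext fun a => ?_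
    ext <;> simp [extMap]
  have hid : ∀ x : F.toFunctor.obj (dualNum S),
      F.toFunctor.map (extMap (LinearMap.id : S →ₗ[S] S)) x = x := by
    intro x
    have : extMap (R := R) (LinearMap.id : S →ₗ[S] S) = AlgHom.id R _ := by
      refine AlgHom.ext fun a => ?_
      ext <;> simp [extMap]
    rw [this, F.toFunctor.map_id]
  have hzero : ∀ x : F.tangent.carrier S,
      F.toFunctor.map (extMap (0 : S →ₗ[S] S)) (tangentVec x) = 0 := by
    intro x
    have : extMap (R := R) (0 : S →ₗ[S] S) = (dualInl R S).comp (dualFst R S) := by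
      refine AlgHom.ext fun a => ?_
      ext <;> simp [extMap]
    rw [this, F.toFunctor.map_comp, map_fst_tangentVec, _root_.map_zero]
  have h₁ : F.toFunctor.map (extMap (LinearMap.fst S S S)) z = tangentVec x := by
    rw [_root_.map_add, c, c, LinearMap.fst_comp_inl, LinearMap.fst_comp_inr, hid, hzero, add_zero]
  have h₂ : F.toFunctor.map (extMap (LinearMap.snd S S S)) z = tangentVec y := by
    rw [_root_.map_add, c, c, LinearMap.snd_comp_inl, LinearMap.snd_comp_inr, hid, hzero, zero_add]
  have h₃ : F.toFunctor.map (extMap (LinearMap.fst S S S + LinearMap.snd S S S)) z =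
      tangentVec (x + y) := by
    rw [_root_.map_add, c, c, LinearMap.add_comp, LinearMap.add_comp, LinearMap.fst_comp_inl,
      LinearMap.fst_comp_inr, LinearMap.snd_comp_inl, LinearMap.snd_comp_inr, add_zero, zero_add,
      hid, hid, tangentVec_add]
  rw [← h₁, ← h₂, ← h₃, symm_map e he, symm_map e he, symm_map e he]
  simp [extMap]

theorem symm_tangentVec_smul_snd {S : Type u} [CommRing S] [Algebra R S] (s : S)
    (y : F.tangent.carrier S) (a : A) : ((e _).symm (tangentVec (s • y)) a).snd =
      s * ((e _).symm (tangentVec y) a).snd := by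
  rw [tangentVec_smul, symm_map e he]
  simp [extMap]

/-- The derivation at the origin given by a tangent vector. -/
def formOfTangent {S : Type u} [CommRing S] [Algebra R S] (y : F.tangent.carrier S) :
    cotangentAt ((e R).symm 0) →ₗ[R] S :=
  Submodule.liftQ _ (dualSnd R S ∘ₗ ((e _).symm (tangentVec y)).toLinearMap) (by
    rw [cotangentRel, Submodule.span_le]
    rintro z (rfl | ⟨a, b, ha, hb, rfl⟩)
    · simp
    · change ((e _).symm (tangentVec y) (a * b)).snd = 0
      rw [_root_.map_mul, TrivSqZeroExt.snd_mul, symm_tangentVec_fst e he,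
        symm_tangentVec_fst e he, ha, hb]
      simp)

/-- The isomorphism from the tangent space at the origin to the space of derivations. -/
def tangentHom : Hom F.tangent.toFunctor (homFunctor R (cotangentAt ((e R).symm 0))) where
  app S _ _ :=
    { toFun := formOfTangent e he
      map_add' := fun x y => by
        refine LinearMap.ext fun a => ?_
        obtain ⟨a, rfl⟩ := Submodule.Quotient.mk_surjective _ a
        exact symm_tangentVec_add_snd e he x y a
      map_smul' := fun s y => by
        refine LinearMap.ext fun a => ?_
        obtain ⟨a, rfl⟩ := Submodule.Quotient.mk_surjective _ a
        exact symm_tangentVec_smul_snd e he s y a }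
  naturality {S T} _ _ _ _ f y := by
    refine LinearMap.ext fun a => ?_
    obtain ⟨a, rfl⟩ := Submodule.Quotient.mk_surjective _ a
    change ((e _).symm (tangentVec (F.tangent.toFunctor.map f y)) a).snd =
      f ((e _).symm (tangentVec y) a).snd
    rw [map_tangentVec, symm_map e he]
    exact dualMap_snd f _

/-- A derivation D gives an algebra morphism A → S[ε] that reduces to the origin, hence a point of
F(S[ε]) above 0. By the assumption on G this point has the form εy with a unique y. -/
theorem isIso_tangentHom (hG : G.IsTangentSelf) : (tangentHom e he).IsIso := by
  intro S _ _
  constructor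
  · intro x y h
    apply tangentVec_injective hG
    apply (e _).symm.injective
    refine AlgHom.ext fun a => TrivSqZeroExt.ext ?_ ?_
    · rw [symm_tangentVec_fst e he, symm_tangentVec_fst e he]
    · exact LinearMap.congr_fun h (Submodule.Quotient.mk a)
  · intro D
    change cotangentAt ((e R).symm 0) →ₗ[R] S at D
    have h : F.toFunctor.map (dualFst R S) (e _ (algHomOfForm _ D)) = 0 := by
      have h₁ : (dualFst R S).comp (algHomOfForm _ D) = (e S).symm 0 :=
        (AlgHom.ext fun a => algHomOfForm_fst _ D a).trans (symm_zero e he S).symm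
      rw [← he, h₁, Equiv.apply_symm_apply]
    obtain ⟨y, hy⟩ := exists_tangentVec hG _ h
    refine ⟨y, LinearMap.ext fun a => ?_⟩
    obtain ⟨a, rfl⟩ := Submodule.Quotient.mk_surjective _ a
    change ((e _).symm (tangentVec y) a).snd = _
    rw [hy, Equiv.symm_apply_apply, algHomOfForm_snd]

end tangent

/-- Together with `Sub.le_tangent`, this encloses every affine submodule of G in a submodule scheme
associated with a module. -/
theorem Sub.isAssociatedScheme_tangent {G : ModuleFunctor.{u, w} R} (hG : G.IsTangentSelf)
    {F : Sub G} (hF : F.toFunctor.IsAffineScheme) : F.tangent.toFunctor.IsAssociatedScheme := by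
  obtain ⟨A, _, _, e, he⟩ := hF
  exact isAssociatedScheme_of_isIso (tangentHom e he) (isIso_tangentHom e he hG)

/-- For the converse, F is viewed as a submodule of itself: its tangent space is then all of F, and
`IsReflexive.isTangentSelf` makes this tangent space a module scheme. -/
theorem isAssociatedScheme_iff_reflexive_affine (F : ModuleFunctor.{u, w} R) :
    F.IsAssociatedScheme ↔ F.IsReflexive ∧ F.IsAffineScheme := by
  refine ⟨fun h => ⟨h.isReflexive, h.isAffineScheme⟩, fun ⟨h₁, h₂⟩ => ?_⟩
  let V : Sub F := { carrier := fun S _ _ => ⊤, map_mem := fun _ _ _ => trivial }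
  have hV : V.toFunctor.IsAffineScheme := by
    obtain ⟨A, _, _, e, he⟩ := h₂
    exact ⟨A, _, _, fun S _ _ => (e S).trans (Equiv.Set.univ _).symm,
      fun S T _ _ _ _ f a => Subtype.ext (he S T f a)⟩
  refine (Sub.isAssociatedScheme_tangent h₁.isTangentSelf hV).of_isIso V.tangent.incl ?_
  exact fun S _ _ => ⟨Subtype.val_injective, fun x => ⟨⟨x, trivial⟩, rfl⟩⟩

/-! ### Morphisms from `𝓡ⁿ` -/

/-- The isomorphism from `𝓡ⁿ` to `S ↦ Hom_R(Rⁿ, S)`. -/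
def powToHomFunctor (R : Type u) [CommRing R] (n : ℕ) :
    Hom (ringPow R n) (homFunctor R (Fin n → R)) where
  app S _ _ :=
    { toFun := fun s => Fintype.linearCombination R s
      map_add' := fun s t => by
        refine LinearMap.ext fun r => ?_
        simp [Fintype.linearCombination_apply, Finset.sum_add_distrib]
      map_smul' := fun s t => by
        refine LinearMap.ext fun r => ?_
        simp [Fintype.linearCombination_apply, Finset.mul_sum] }
  naturality f s := by
    refine LinearMap.ext fun r => ?_
    simp [Fintype.linearCombination_apply]

theorem powToHomFunctor_apply {n : ℕ} {S : Type u} [CommRing S] [Algebra R S] (s : Fin n → S)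
    (r : Fin n → R) : (powToHomFunctor R n).app S s r = ∑ a, r a • s a := rfl

theorem isIso_powToHomFunctor (n : ℕ) : (powToHomFunctor R n).IsIso := by
  intro S _ _
  constructor
  · intro s t h
    funext a
    have := LinearMap.congr_fun h (Pi.single a 1)
    rw [powToHomFunctor_apply, powToHomFunctor_apply] at this
    simpa [Pi.single_apply] using this
  · intro w
    refine ⟨fun a => w (Pi.single a 1), LinearMap.pi_ext' fun a => LinearMap.ext_ring ?_⟩
    change (powToHomFunctor R n).app S (fun a => w (Pi.single a 1)) (Pi.single a 1) =
      w (Pi.single a 1)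
    rw [powToHomFunctor_apply]
    simp [Pi.single_apply]

theorem app_eq_sum_smul {F : ModuleFunctor.{u, w} R} {n : ℕ} (f : Hom (ringPow R n) F)
    {S : Type u} [CommRing S] [Algebra R S] (s : Fin n → S) :
    f.app S s = ∑ a, s a • F.map (Algebra.ofId R S) (f.app R (Pi.single a 1)) := by
  have h : s = ∑ a, s a • (ringPow R n).map (Algebra.ofId R S) (Pi.single a 1) := by
    funext b
    simp [Finset.sum_apply, Pi.single_apply, apply_ite]
  conv_lhs => rw [h]
  rw [map_sum]
  refine Finset.sum_congr rfl fun a _ => ?_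
  rw [_root_.map_smul, f.naturality]

section

variable {M : Type w} [AddCommGroup M] [Module R M]

theorem Hom.exists_eq_sum_tmul {n : ℕ} (f : Hom (ringPow R n) (quasiCoherent R M)) :
    ∃ x : Fin n → M, ∀ (S : Type u) [CommRing S] [Algebra R S] (s : Fin n → S),
      f.app S s = ∑ a, s a ⊗ₜ[R] x a := by
  refine ⟨fun a => TensorProduct.lid R M (f.app R (Pi.single a 1)), fun S _ _ s => ?_⟩
  rw [app_eq_sum_smul]
  refine Finset.sum_congr rfl fun a _ => ?_
  obtain ⟨m, hm⟩ := (TensorProduct.lid R M).symm.surjective (f.app R (Pi.single a 1))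
  change _ = s a ⊗ₜ[R] TensorProduct.lid R M (f.app R (Pi.single a 1))
  rw [← hm]
  simp [TensorProduct.smul_tmul']

/-- The morphism `w ↦ ∑ w(cⱼ) ⊗ yⱼ` from `Hom_R(N, -)` to `𝓜`. -/
noncomputable def tensorHom {N : Type u} [AddCommGroup N] [Module R N] {k : ℕ} (c : Fin k → N)
    (y : Fin k → M) : Hom (homFunctor R N) (quasiCoherent R M) where
  app S _ _ :=
    { toFun := fun w => ∑ j, w (c j) ⊗ₜ[R] y j
      map_add' := fun v w => by simp [TensorProduct.add_tmul, Finset.sum_add_distrib]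
      map_smul' := fun s w => by simp [Finset.smul_sum, TensorProduct.smul_tmul'] }
  naturality f w := by simp

theorem tensorHom_apply {N : Type u} [AddCommGroup N] [Module R N] {k : ℕ} (c : Fin k → N)
    (y : Fin k → M) {S : Type u} [CommRing S] [Algebra R S] (w : N →ₗ[R] S) :
    (tensorHom c y).app S w = ∑ j, w (c j) ⊗ₜ[R] y j := rfl

/-- The morphism `s ↦ ∑ sₐ ⊗ xₐ` from `𝓡ⁿ` to `𝓜`. -/
noncomputable def powHom {n : ℕ} (x : Fin n → M) : Hom (ringPow R n) (quasiCoherent R M) :=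
  (tensorHom (fun a => Pi.single a (1 : R)) x).comp (powToHomFunctor R n)

theorem powHom_apply {n : ℕ} (x : Fin n → M) {S : Type u} [CommRing S] [Algebra R S]
    (s : Fin n → S) : (powHom (R := R) x).app S s = ∑ a, s a ⊗ₜ[R] x a := by
  rw [powHom, Hom.comp_app, tensorHom_apply]
  refine Finset.sum_congr rfl fun a _ => ?_
  rw [powToHomFunctor_apply]
  simp [Pi.single_apply]

end

/-- The linear maps on N that vanish on Q are those on N ⧸ Q. All kernels below are shown to be
module schemes by exhibiting such a Q. -/
theorem Sub.isAssociatedScheme_of_mem_iff {F : ModuleFunctor.{u, w} R} {N : Type u}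
    [AddCommGroup N] [Module R N] (e : Hom F (homFunctor R N)) (he : e.IsIso) (V : Sub F)
    (Q : Submodule R N) (h : ∀ (S : Type u) [CommRing S] [Algebra R S] (y : F.obj S),
      y ∈ V.carrier S ↔ ∀ q ∈ Q, e.app S y q = 0) : V.toFunctor.IsAssociatedScheme := by
  let d : Hom V.toFunctor (homFunctor R (N ⧸ Q)) :=
    { app := fun S _ _ =>
        { toFun := fun y => Q.liftQ (e.app S y.1) ((h S y.1).1 y.2)
          map_add' := fun x y => by
            refine Submodule.linearMap_qext _ (LinearMap.ext fun n => ?_)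
            exact LinearMap.congr_fun (_root_.map_add (e.app S) x.1 y.1) n
          map_smul' := fun s y => by
            refine Submodule.linearMap_qext _ (LinearMap.ext fun n => ?_)
            exact LinearMap.congr_fun (_root_.map_smul (e.app S) s y.1) n }
      naturality := fun f y => by
        refine Submodule.linearMap_qext _ (LinearMap.ext fun n => ?_)
        exact LinearMap.congr_fun (e.naturality f y.1) n }
  refine isAssociatedScheme_of_isIso d fun S _ _ => ⟨fun x y hxy => ?_, fun w => ?_⟩
  · refine Subtype.ext ((he S).1 (LinearMap.ext fun n => ?_))
    exact LinearMap.congr_fun hxy (Submodule.Quotient.mk n)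
  · change (N ⧸ Q) →ₗ[R] S at w
    obtain ⟨y, hy⟩ := (he S).2 (w ∘ₗ Q.mkQ)
    refine ⟨⟨y, (h S y).2 fun q hq => ?_⟩, ?_⟩
    · rw [hy, LinearMap.comp_apply, Submodule.mkQ_apply, (Submodule.Quotient.mk_eq_zero Q).2 hq,
        _root_.map_zero]
    · refine Submodule.linearMap_qext _ (LinearMap.ext fun n => ?_)
      exact LinearMap.congr_fun hy n

/-- With W ≅ 𝓥^*, the images of the eₐ are linear forms hₐ on V, and each v in V imposes the
equation ∑ hₐ(v) sₐ = 0. -/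
theorem Hom.ker_isAssociatedScheme_of_factorsThrough {F : ModuleFunctor.{u, w} R} {n : ℕ}
    (f : Hom (ringPow R n) F) {W : Sub F} (hW : W.toFunctor.IsAssociatedScheme)
    (hf : f.FactorsThrough W) : f.ker.toFunctor.IsAssociatedScheme := by
  obtain ⟨g, hg⟩ := hf
  obtain ⟨V, _, _, e', he'⟩ := isAssociatedScheme_iff.1 hW
  let h := (e'.inv he').comp g
  refine Sub.isAssociatedScheme_of_mem_iff (powToHomFunctor R n) (isIso_powToHomFunctor n) _
    -- The coefficient vectors (hₐ(v))ₐ, for v in V.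
    (LinearMap.range (LinearMap.pi fun a => h.app R (Pi.single a 1))) fun S _ _ s => ?_
  have h₁ : s ∈ f.ker.carrier S ↔ h.app S s = 0 := by
    change f.app S s = 0 ↔ (e'.inv he').app S (g.app S s) = 0
    rw [← hg S s, map_eq_zero_iff _ ((e'.isIso_inv he') S).1]
    exact Submodule.coe_eq_zero
  rw [h₁, app_eq_sum_smul]
  constructor
  · rintro h₂ _ ⟨v, rfl⟩
    have := LinearMap.congr_fun h₂ v
    rw [powToHomFunctor_apply]
    simpa [Algebra.smul_def, mul_comm, Algebra.ofId_apply] using this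
  · intro h₂
    refine LinearMap.ext fun v => ?_
    have := h₂ _ ⟨v, rfl⟩
    rw [powToHomFunctor_apply] at this
    simpa [Algebra.smul_def, mul_comm, Algebra.ofId_apply] using this

/-! ### Coefficients -/

section Coefficients

variable {M : Type u} [AddCommGroup M] [Module R M] {n : ℕ}

/-- The element `∑ eₐ ⊗ xₐ` of `Rⁿ ⊗ M` comes from `L ⊗ M`. -/
def CoeffIn (L : Submodule R (Fin n → R)) (x : Fin n → M) : Prop :=
  ∃ (k : ℕ) (c : Fin k → Fin n → R) (y : Fin k → M), (∀ j, c j ∈ L) ∧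
    ∀ a, x a = ∑ j, c j a • y j

theorem sum_tmul_eq {S : Type u} [AddCommGroup S] [Module R S] {k : ℕ} {x : Fin n → M}
    {c : Fin k → Fin n → R} {y : Fin k → M} (h : ∀ a, x a = ∑ j, c j a • y j) (s : Fin n → S) :
    ∑ a, s a ⊗ₜ[R] x a = ∑ j, (∑ a, c j a • s a) ⊗ₜ[R] y j := by
  simp_rw [h, TensorProduct.tmul_sum, TensorProduct.sum_tmul, TensorProduct.tmul_smul,
    TensorProduct.smul_tmul']
  exact Finset.sum_comm

theorem CoeffIn.sum_tmul_eq_zero {L : Submodule R (Fin n → R)} {x : Fin n → M} (h : CoeffIn L x)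
    {S : Type u} [AddCommGroup S] [Module R S] {s : Fin n → S}
    (hs : ∀ r ∈ L, ∑ a, r a • s a = 0) : ∑ a, s a ⊗ₜ[R] x a = 0 := by
  obtain ⟨k, c, y, hc, hx⟩ := h
  rw [sum_tmul_eq hx]
  exact Finset.sum_eq_zero fun j _ => by rw [hs _ (hc j), TensorProduct.zero_tmul]

/-- The kernel condition tests algebras only. Replacing a module N by the algebra R ⊕ N lets it test
modules as well. -/
theorem sum_tmul_sqZeroInr {N : Type u} [AddCommGroup N] [Module R N] {v : Fin n → N}
    {x : Fin n → M} : ∑ a, sqZeroInr R R N (v a) ⊗ₜ[R] x a = 0 ↔ ∑ a, v a ⊗ₜ[R] x a = 0 := by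
  constructor
  · intro h
    have := congrArg (TensorProduct.map ((TensorProduct.lid R N).toLinearMap ∘ₗ sqZeroSnd R R N)
      (LinearMap.id : M →ₗ[R] M)) h
    simpa [sqZeroInr_apply] using this
  · intro h
    have := congrArg (TensorProduct.map (sqZeroInr R R N) (LinearMap.id : M →ₗ[R] M)) h
    simpa using this

theorem sqZeroInr_injective {N : Type u} [AddCommGroup N] [Module R N] :
    Function.Injective (sqZeroInr R R N) := by
  intro x y h
  have := congrArg (TensorProduct.lid R N ∘ TrivSqZeroExt.snd) h
  simpa [sqZeroInr_apply] using this

/-- If the kernel is 𝓥^*, its a-th coordinate is a linear form on 𝓥^*, hence evaluation at some vₐ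
in V. The relation ∑ vₐ ⊗ xₐ = 0 is the universal one, read off at the point V → R ⊕ V. -/
theorem exists_representing (x : Fin n → M)
    (h : (powHom (R := R) x).ker.toFunctor.IsAssociatedScheme) :
    ∃ (V : Type u) (_ : AddCommGroup V) (_ : Module R V) (v : Fin n → V),
      Submodule.span R (Set.range v) = ⊤ ∧ ∑ a, v a ⊗ₜ[R] x a = 0 ∧
      ∀ (S : Type u) [CommRing S] [Algebra R S] (s : Fin n → S), ∑ a, s a ⊗ₜ[R] x a = 0 →
        ∃ w : V →ₗ[R] S, ∀ a, w (v a) = s a := by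
  obtain ⟨V, _, _, e, he⟩ := isAssociatedScheme_iff.1 h
  have hv : ∀ a : Fin n, ∃ v : V, ∀ (S : Type u) [CommRing S] [Algebra R S] (w : V →ₗ[R] S),
      (e.app S w).1 a = w v := by
    intro a
    let φ : RestrictHom (homFunctor R V) (ring R) R :=
      { app := fun T _ _ _ => LinearMap.proj a ∘ₗ (Submodule.subtype _) ∘ₗ e.app T
        naturality := fun g h x => by
          have := congrArg (fun y => y.1 a) (e.naturality h x)
          exact this }
    obtain ⟨k, r, m, hφ⟩ := φ.exists_sum_ring
    refine ⟨∑ b, r b • m b, fun S _ _ w => ?_⟩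
    have := hφ S (Algebra.ofId R S) w
    refine this.trans ?_
    simp [Algebra.smul_def, Algebra.ofId_apply]
  choose v hv using hv
  have hmem : ∀ (S : Type u) [CommRing S] [Algebra R S] (w : V →ₗ[R] S),
      ∑ a, w (v a) ⊗ₜ[R] x a = 0 := by
    intro S _ _ w
    have := (e.app S w).2
    change (powHom x).app S (e.app S w).1 = 0 at this
    rw [powHom_apply] at this
    simpa only [hv] using this
  refine ⟨V, inferInstance, inferInstance, v, ?_, ?_, fun S _ _ s hs => ?_⟩
  · let Q := Submodule.span R (Set.range v)
    -- The quotient map V → V ⧸ Q, viewed in R ⊕ V ⧸ Q, is a point of the kernel whose coordinates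
    -- all vanish, so it is zero and the vₐ generate V.
    have h₁ : sqZeroInr R R (V ⧸ Q) ∘ₗ Q.mkQ = 0 := by
      apply (he _).1
      refine Subtype.ext (funext fun a => ?_)
      rw [hv, hv, LinearMap.comp_apply, Submodule.mkQ_apply,
        (Submodule.Quotient.mk_eq_zero Q).2 (Submodule.subset_span ⟨a, rfl⟩)]
      simp
    rw [eq_top_iff]
    intro y _
    have h₂ := LinearMap.congr_fun h₁ y
    exact (Submodule.Quotient.mk_eq_zero Q).1
      (sqZeroInr_injective (h₂.trans (_root_.map_zero (sqZeroInr R R (V ⧸ Q))).symm))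
  · exact sum_tmul_sqZeroInr.1 (hmem _ (sqZeroInr R R V))
  · obtain ⟨w, hw⟩ := (he S).2 ⟨s, by
      change (powHom x).app S s = 0
      rw [powHom_apply, hs]⟩
    exact ⟨w, fun a => by rw [← hv, hw]⟩

/-- `N` is the smallest submodule of `Rⁿ` with `∑ eₐ ⊗ xₐ` in `N ⊗ M`, and the kernel of
`𝓡ⁿ → 𝓜` is its annihilator. -/
structure IsCoeffModule (N : Submodule R (Fin n → R)) (x : Fin n → M) : Prop where
  coeffIn : CoeffIn N x
  le : ∀ L, CoeffIn L x → N ≤ L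
  sum_smul_eq_zero : ∀ (S : Type u) [CommRing S] [Algebra R S] (s : Fin n → S),
    ∑ a, s a ⊗ₜ[R] x a = 0 → ∀ r ∈ N, ∑ a, r a • s a = 0

/-- N consists of the relations between the vₐ. Since the vₐ generate V, the relation ∑ vₐ ⊗ xₐ = 0
vanishes trivially, which writes the xₐ with coefficients in N. Specialising the universal relation
shows that N annihilates the kernel. -/
theorem exists_isCoeffModule (x : Fin n → M)
    (h : (powHom (R := R) x).ker.toFunctor.IsAssociatedScheme) :
    ∃ N : Submodule R (Fin n → R), IsCoeffModule N x := by
  obtain ⟨V, _, _, v, hspan, hvx, hV⟩ := exists_representing x h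
  have h₃ : ∀ (S : Type u) [CommRing S] [Algebra R S] (s : Fin n → S),
      ∑ a, s a ⊗ₜ[R] x a = 0 → ∀ r ∈ LinearMap.ker (Fintype.linearCombination R v),
      ∑ a, r a • s a = 0 := by
    intro S _ _ s hs r hr
    obtain ⟨w, hw⟩ := hV S s hs
    rw [LinearMap.mem_ker, Fintype.linearCombination_apply] at hr
    have := congrArg w hr
    simpa [hw] using this
  refine ⟨LinearMap.ker (Fintype.linearCombination R v), ?_, fun L hL r hr => ?_, h₃⟩
  · obtain ⟨k, a, y, hx, ha⟩ := TensorProduct.vanishesTrivially_of_sum_tmul_eq_zero R hspan hvx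
    refine ⟨k, fun j i => a i j, y, fun j => ?_, hx⟩
    rw [LinearMap.mem_ker, Fintype.linearCombination_apply]
    exact ha j
  -- Minimality: the classes of the eₐ modulo L solve the equation, so a relation r in N holds
  -- between them, which says that r lies in L.
  · have h₁ : ∑ a, (L.mkQ (Pi.single a 1)) ⊗ₜ[R] x a = 0 := by
      refine hL.sum_tmul_eq_zero fun r hr => ?_
      rw [← Submodule.Quotient.mk_eq_zero L] at hr
      rw [← hr, ← Submodule.mkQ_apply]
      conv_rhs => rw [pi_eq_sum_univ' r, map_sum]
      refine Finset.sum_congr rfl fun a _ => ?_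
      rw [_root_.map_smul]
    have h₂ := h₃ _ _ (sum_tmul_sqZeroInr.2 h₁) r hr
    rw [← Submodule.Quotient.mk_eq_zero L]
    apply sqZeroInr_injective (R := R)
    rw [_root_.map_zero, ← h₂, ← Submodule.mkQ_apply]
    conv_lhs => rw [pi_eq_sum_univ' r, map_sum, map_sum]
    refine Finset.sum_congr rfl fun a _ => ?_
    rw [_root_.map_smul, _root_.map_smul]

/-- A relation ∑ rₐxₐ = 0 is an R-point of the kernel, so it is annihilated by N; writing the xₐ
with coefficients in N shows the relation to be trivial. -/
theorem flat_of_forall_ker (h : ∀ (n : ℕ) (x : Fin n → M),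
    (powHom (R := R) x).ker.toFunctor.IsAssociatedScheme) : Module.Flat R M := by
  refine Module.Flat.of_forall_isTrivialRelation fun {l r x} hrx => ?_
  obtain ⟨N, hN⟩ := exists_isCoeffModule x (h l x)
  obtain ⟨k, c, y, hc, hx⟩ := hN.coeffIn
  refine ⟨k, fun i j => c j i, y, hx, fun j => ?_⟩
  have h₁ : ∑ a, r a ⊗ₜ[R] x a = 0 := by
    apply (TensorProduct.lid R M).injective
    simpa using hrx
  have := hN.sum_smul_eq_zero R r h₁ _ (hc j)
  simpa [mul_comm] using this

/-- If w : N → S is sent to zero, flatness makes the relation ∑ w(cⱼ) ⊗ yⱼ = 0 vanish trivially. The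
xₐ can then be rewritten with coefficients in Ker w, so minimality of N gives w = 0. -/
theorem IsCoeffModule.isMono_tensorHom [Module.Flat R M] {N : Submodule R (Fin n → R)}
    {x : Fin n → M} (hN : IsCoeffModule N x) {k : ℕ} (c : Fin k → N) (y : Fin k → M)
    (hx : ∀ a, x a = ∑ j, (c j).1 a • y j) : (tensorHom (R := R) c y).IsMono := by
  intro S _ _
  rw [injective_iff_map_eq_zero]
  intro w hw
  change N →ₗ[R] S at w
  rw [tensorHom_apply] at hw
  obtain ⟨l, b, z, hy, hb⟩ :=
    TensorProduct.vanishesTrivially_of_sum_tmul_eq_zero_of_rTensor_injective R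
      (Module.Flat.rTensor_preserves_injective_linearMap _ (Submodule.subtype_injective _)) hw
  have h₁ : N ≤ (LinearMap.ker w).map N.subtype := by
    -- The new coefficient vectors are the combinations ∑ⱼ bⱼᵢ cⱼ, which w kills.
    refine hN.le _ ⟨l, fun i => ∑ j, b j i • (c j).1, z, fun i => ?_, fun a => ?_⟩
    · refine ⟨∑ j, b j i • c j, ?_, by simp⟩
      rw [SetLike.mem_coe, LinearMap.mem_ker, map_sum, ← hb i]
      simp
    · rw [hx]
      simp_rw [hy, Finset.smul_sum, Finset.sum_apply, Finset.sum_smul, Pi.smul_apply, smul_smul]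
      rw [Finset.sum_comm]
      refine Finset.sum_congr rfl fun i _ => Finset.sum_congr rfl fun j _ => ?_
      rw [smul_eq_mul, mul_comm]
  refine LinearMap.ext fun m => ?_
  obtain ⟨m', hm', e⟩ := h₁ m.2
  rw [← Subtype.ext e]
  exact hm'

end Coefficients

/-! ### Direct limits -/

section Limits

variable {M : Type u} [AddCommGroup M] [Module R M]

theorem Sub.tmul_mem {W : Sub (quasiCoherent R M)} {m : M}
    (hm : (1 : R) ⊗ₜ[R] m ∈ W.carrier R) {S : Type u} [CommRing S] [Algebra R S] (s : S) :
    s ⊗ₜ[R] m ∈ W.carrier S := by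
  have h := W.map_mem (Algebra.ofId R S) hm
  change TensorProduct.map (Algebra.ofId R S).toLinearMap LinearMap.id ((1 : R) ⊗ₜ[R] m) ∈ _ at h
  have h' := Submodule.smul_mem _ s h
  simpa [TensorProduct.smul_tmul'] using h'

theorem factorsThrough_iff_tmul_mem {n : ℕ} {f : Hom (ringPow R n) (quasiCoherent R M)}
    {x : Fin n → M} (hx : ∀ (S : Type u) [CommRing S] [Algebra R S] (s : Fin n → S),
      f.app S s = ∑ a, s a ⊗ₜ[R] x a) {W : Sub (quasiCoherent R M)} :
    f.FactorsThrough W ↔ ∀ a, (1 : R) ⊗ₜ[R] x a ∈ W.carrier R := by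
  rw [Hom.factorsThrough_iff]
  constructor
  · intro h a
    have := h R (Pi.single a 1)
    rw [hx] at this
    convert this
    rw [Finset.sum_eq_single a]
    · simp
    · intro b _ hb
      simp [hb]
    · simp
  · intro h S _ _ s
    rw [hx]
    exact sum_mem fun a _ => Sub.tmul_mem (h a) (s a)

theorem exists_eq_sum_fin {S : Type u} [CommRing S] [Algebra R S] (z : S ⊗[R] M) :
    ∃ (n : ℕ) (s : Fin n → S) (x : Fin n → M), z = ∑ a, s a ⊗ₜ[R] x a := by
  induction z using TensorProduct.induction_on with
  | zero => exact ⟨0, Fin.elim0, Fin.elim0, by simp⟩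
  | tmul s m => exact ⟨1, fun _ => s, fun _ => m, by simp⟩
  | add y z hy hz =>
    obtain ⟨n, s, x, rfl⟩ := hy
    obtain ⟨n', s', x', rfl⟩ := hz
    exact ⟨n + n', Fin.append s s', Fin.append x x', by simp [Fin.sum_univ_add]⟩

/-- Each W i lies in the image of some w ↦ ∑ w(nₐ) ⊗ mₐ, so any submodule containing the finitely
many mₐ contains W i. Capturing finite families thus yields directedness as well as surjectivity;
injectivity holds because the W i are submodules. -/
theorem isDirectLimitOfSubs_quasiCoherent {ι : Type w₃} [Preorder ι]
    (W : ι → Sub (quasiCoherent R M)) (hW : Monotone W) (hW' : ∀ i j, W i ≤ W j → i ≤ j)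
    (hx : ∀ (n : ℕ) (x : Fin n → M), ∃ i, ∀ a, (1 : R) ⊗ₜ[R] x a ∈ (W i).carrier R)
    (hle : ∀ i, ∃ (N : Type u) (_ : AddCommGroup N) (_ : Module R N)
      (f : Hom (homFunctor R N) (quasiCoherent R M)), W i ≤ f.range) :
    (quasiCoherent R M).IsDirectLimitOfSubs W hW := by
  have hd : IsDirectedOrder ι := by
    refine ⟨fun i j => ?_⟩
    obtain ⟨N₁, _, _, f₁, h₁⟩ := hle i
    obtain ⟨N₂, _, _, f₂, h₂⟩ := hle j
    obtain ⟨k₁, n₁, m₁, e₁⟩ := f₁.exists_sum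
    obtain ⟨k₂, n₂, m₂, e₂⟩ := f₂.exists_sum
    obtain ⟨l, hl⟩ := hx _ (Fin.append m₁ m₂)
    refine ⟨l, hW' _ _ fun S _ _ => (h₁ S).trans ?_, hW' _ _ fun S _ _ => (h₂ S).trans ?_⟩
    · rintro _ ⟨w, rfl⟩
      rw [e₁]
      refine sum_mem fun a _ => Sub.tmul_mem ?_ _
      simpa using hl (Fin.castAdd k₂ a)
    · rintro _ ⟨w, rfl⟩
      rw [e₂]
      refine sum_mem fun a _ => Sub.tmul_mem ?_ _
      simpa using hl (Fin.natAdd k₁ a)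
  refine ⟨?_, hd, fun S _ _ => ⟨fun _ _ => rfl, fun _ _ _ _ _ _ => rfl⟩,
    fun S _ _ _ _ _ _ => rfl, fun S _ _ _ => ⟨?_, fun z => ?_⟩⟩
  · obtain ⟨i, -⟩ := hx 0 Fin.elim0
    exact ⟨i⟩
  · exact Module.DirectLimit.lift_injective _ _ fun i => Subtype.val_injective
  · obtain ⟨n, s, x, rfl⟩ := exists_eq_sum_fin z
    obtain ⟨i, hi⟩ := hx n x
    refine ⟨Module.DirectLimit.of S ι (fun i => (W i).toFunctor.obj S) _ i
      ⟨∑ a, s a ⊗ₜ[R] x a, sum_mem fun a _ => Sub.tmul_mem (hi a) (s a)⟩, ?_⟩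
    exact Module.DirectLimit.lift_of ..

theorem IsDirectLimit.exists_tmul_mem_range {ι : Type w₃} [Preorder ι]
    {F : ι → ModuleFunctor.{u, w₁} R} {t : ∀ i j, i ≤ j → Hom (F i) (F j)}
    {c : ∀ i, Hom (F i) (quasiCoherent R M)} (h : IsDirectLimit F t (quasiCoherent R M) c)
    {n : ℕ} (x : Fin n → M) : ∃ i, ∀ a, (1 : R) ⊗ₜ[R] x a ∈ (c i).range.carrier R := by
  classical
  have := h.nonempty
  have := h.directed
  have hi : ∀ a, ∃ i, (1 : R) ⊗ₜ[R] x a ∈ (c i).range.carrier R := by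
    intro a
    obtain ⟨z, hz⟩ := (h.bijective R).2 ((1 : R) ⊗ₜ[R] x a)
    obtain ⟨i, y, rfl⟩ := Module.DirectLimit.exists_of z
    rw [Module.DirectLimit.lift_of] at hz
    exact ⟨i, y, hz⟩
  choose i hi using hi
  obtain ⟨j, hj⟩ := Finite.exists_le i
  refine ⟨j, fun a => ?_⟩
  obtain ⟨y, hy⟩ := hi a
  exact ⟨(t _ _ (hj a)).app R y, (h.compatible R _ _ (hj a) y).trans hy⟩

theorem IsDirectLimitOfSubs.exists_tmul_mem {ι : Type w₃} [Preorder ι]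
    {W : ι → Sub (quasiCoherent R M)} {hW : Monotone W}
    (h : (quasiCoherent R M).IsDirectLimitOfSubs W hW) {n : ℕ} (x : Fin n → M) :
    ∃ i, ∀ a, (1 : R) ⊗ₜ[R] x a ∈ (W i).carrier R := by
  obtain ⟨i, hi⟩ := IsDirectLimit.exists_tmul_mem_range h x
  refine ⟨i, fun a => ?_⟩
  obtain ⟨y, hy⟩ := hi a
  rw [← hy]
  exact y.2

/-- An element that dies in the limit already dies at a finite stage, where the transition map is
injective. -/
theorem IsDirectLimit.isMono {ι : Type w₃} [Preorder ι]
    {F : ι → ModuleFunctor.{u, w₁} R} {t : ∀ i j, i ≤ j → Hom (F i) (F j)}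
    {G : ModuleFunctor.{u, w₂} R} {c : ∀ i, Hom (F i) G} (h : IsDirectLimit F t G c)
    (ht : ∀ i j hij, (t i j hij).IsMono) (i : ι) : (c i).IsMono := by
  classical
  intro S _ _
  have := h.nonempty
  have := h.directed
  have := h.system S
  rw [injective_iff_map_eq_zero]
  intro y hy
  have h₁ : Module.DirectLimit.of S ι (fun i => (F i).obj S) (fun i j h => (t i j h).app S) i y
      = 0 := by
    apply (h.bijective S).1
    rw [Module.DirectLimit.lift_of, hy, _root_.map_zero]
  obtain ⟨j, hij, hj⟩ := Module.DirectLimit.of.zero_exact h₁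
  exact (map_eq_zero_iff _ (ht i j hij S)).1 hj

/-- The image of a monomorphism from a module scheme is a module scheme. -/
theorem Hom.IsMono.isAssociatedScheme_range {F : ModuleFunctor.{u, w₁} R}
    {G : ModuleFunctor.{u, w₂} R} {f : Hom F G} (hf : f.IsMono) (hF : F.IsAssociatedScheme) :
    f.range.toFunctor.IsAssociatedScheme :=
  hF.of_isIso _ hf.isIso_rangeRestrict

theorem isAssociatedScheme_homFunctor (N : Type u) [AddCommGroup N] [Module R N] :
    (homFunctor R N).IsAssociatedScheme :=
  ⟨N, _, _, schemeOfToHomFunctor N, isIso_schemeOfToHomFunctor N⟩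

theorem IsAssociatedScheme.exists_le_range {G : ModuleFunctor.{u, w} R} {W : Sub G}
    (hW : W.toFunctor.IsAssociatedScheme) : ∃ (N : Type u) (_ : AddCommGroup N) (_ : Module R N)
      (f : Hom (homFunctor R N) G), W ≤ f.range := by
  obtain ⟨N, _, _, e, he⟩ := isAssociatedScheme_iff.1 hW
  refine ⟨N, _, _, W.incl.comp e, fun S _ _ y hy => ?_⟩
  obtain ⟨w, hw⟩ := (he S).2 ⟨y, hy⟩
  exact ⟨w, congrArg Subtype.val hw⟩

end Limits

/-! ### Small families of submodule schemes -/

section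

variable (R) (M : Type u) [AddCommGroup M] [Module R M]

/-- The data of a submodule scheme of `𝓜` associated with a submodule of some `Rⁿ`. -/
structure SubschemeData : Type u where
  n : ℕ
  k : ℕ
  N : Submodule R (Fin n → R)
  c : Fin k → N
  y : Fin k → M
  isMono : (tensorHom (R := R) c y).IsMono

variable {R M}

/-- The submodule scheme of `𝓜` given by its data. -/
noncomputable def SubschemeData.sub (D : SubschemeData R M) : Sub (quasiCoherent R M) :=
  (tensorHom (R := R) D.c D.y).range

noncomputable instance : Preorder (SubschemeData R M) := Preorder.lift SubschemeData.sub

theorem SubschemeData.isAssociatedScheme (D : SubschemeData R M) :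
    D.sub.toFunctor.IsAssociatedScheme :=
  D.isMono.isAssociatedScheme_range (isAssociatedScheme_homFunctor _)

/-- The submodule scheme is the image of 𝓝^* for the coefficient module N of the xₐ. -/
theorem exists_subschemeData (h : ∀ (n : ℕ) (x : Fin n → M),
    (powHom (R := R) x).ker.toFunctor.IsAssociatedScheme) {n : ℕ} (x : Fin n → M) :
    ∃ D : SubschemeData R M, ∀ a, (1 : R) ⊗ₜ[R] x a ∈ D.sub.carrier R := by
  have := flat_of_forall_ker h
  obtain ⟨N, hN⟩ := exists_isCoeffModule x (h n x)
  obtain ⟨k, c, y, hc, hx⟩ := hN.coeffIn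
  refine ⟨⟨n, k, N, fun j => ⟨c j, hc j⟩, y, hN.isMono_tensorHom _ _ hx⟩, fun a => ?_⟩
  -- xₐ is the image of the a-th coordinate form on N.
  refine ⟨LinearMap.proj a ∘ₗ N.subtype, ?_⟩
  rw [tensorHom_apply, hx, TensorProduct.tmul_sum]
  refine Finset.sum_congr rfl fun j _ => ?_
  simp [TensorProduct.tmul_smul, TensorProduct.smul_tmul']

/-- A morphism w ↦ ∑ w(nₐ) ⊗ mₐ kills w exactly when (w(nₐ))ₐ is annihilated by the coefficient
module L of the mₐ, that is, when w vanishes on the image of L under r ↦ ∑ rₐnₐ. -/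
theorem ker_tensorHom_isAssociatedScheme (h : ∀ (n : ℕ) (x : Fin n → M),
    (powHom (R := R) x).ker.toFunctor.IsAssociatedScheme) {F : ModuleFunctor.{u, w} R}
    {N : Type u} [AddCommGroup N] [Module R N] (e : Hom F (homFunctor R N)) (he : e.IsIso)
    (f : Hom (homFunctor R N) (quasiCoherent R M)) :
    (f.comp e).ker.toFunctor.IsAssociatedScheme := by
  obtain ⟨k, n, m, hf⟩ := f.exists_sum
  obtain ⟨L, hL⟩ := exists_isCoeffModule m (h k m)
  refine Sub.isAssociatedScheme_of_mem_iff e he _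
    (L.map (Fintype.linearCombination R n)) fun S _ _ y => ?_
  change f.app S (e.app S y) = 0 ↔ _
  rw [hf]
  constructor
  · rintro hy _ ⟨r, hr, rfl⟩
    have := hL.sum_smul_eq_zero S _ hy r hr
    simpa [Fintype.linearCombination_apply] using this
  · intro hy
    refine hL.coeffIn.sum_tmul_eq_zero fun r hr => ?_
    have := hy _ ⟨r, hr, rfl⟩
    simpa [Fintype.linearCombination_apply] using this

end

end ModuleFunctor

/-! ### Flat modules as direct limits of free modules -/

section Lazard

variable (R : Type u) [CommRing R] (M : Type u)

/-- The free module on the generators `(m, i)`. -/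
def GenModule : Type u := (M × ℕ) →₀ R

noncomputable instance : AddCommGroup (GenModule R M) := inferInstanceAs (AddCommGroup (_ →₀ R))

noncomputable instance : Module R (GenModule R M) := inferInstanceAs (Module R (_ →₀ R))

/-- The canonical basis of the free module on the generators `(m, i)`. -/
noncomputable def genBasis : Module.Basis (M × ℕ) R (GenModule R M) := .ofRepr (.refl R _)

variable {M}

/-- The submodule spanned by finitely many of the generators `(m, i)`. -/
noncomputable abbrev genSpan (s : Finset (M × ℕ)) : Submodule R (GenModule R M) :=
  Submodule.span R (Set.range fun q : s => genBasis R M q)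

/-- The basis of the submodule spanned by finitely many of the generators `(m, i)`. -/
noncomputable def genSpanBasis (s : Finset (M × ℕ)) : Module.Basis s R (genSpan R s) :=
  Module.Basis.span ((genBasis R M).linearIndependent.comp _ Subtype.val_injective)

variable {R}

theorem genSpanBasis_apply (s : Finset (M × ℕ)) (q : s) :
    (genSpanBasis R s q : GenModule R M) = genBasis R M q :=
  congrArg Subtype.val (Module.Basis.span_apply _ q)

theorem genBasis_mem {s : Finset (M × ℕ)} {q : M × ℕ} (hq : q ∈ s) :
    genBasis R M q ∈ genSpan R s :=
  Submodule.subset_span ⟨⟨q, hq⟩, rfl⟩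

theorem genSpan_mono {s t : Finset (M × ℕ)} (h : s ⊆ t) : genSpan R s ≤ genSpan R t := by
  rw [Submodule.span_le]
  rintro _ ⟨q, rfl⟩
  exact genBasis_mem (h q.2)

instance (s : Finset (M × ℕ)) : Module.Finite R (genSpan R s) :=
  Module.Finite.of_basis (genSpanBasis R s)

instance (s : Finset (M × ℕ)) : Module.Free R (genSpan R s) :=
  Module.Free.of_basis (genSpanBasis R s)

theorem eq_on_genSpan {N : Type*} [AddCommGroup N] [Module R N] {s : Finset (M × ℕ)}
    {f g : genSpan R s →ₗ[R] N}
    (h : ∀ q (hq : q ∈ s), f ⟨genBasis R M q, genBasis_mem hq⟩ = g ⟨genBasis R M q, genBasis_mem hq⟩) :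
    f = g := by
  refine (genSpanBasis R s).ext fun q => ?_
  have : genSpanBasis R s q = ⟨genBasis R M q, genBasis_mem q.2⟩ :=
    Subtype.ext (genSpanBasis_apply s q)
  rw [this]
  exact h q q.2

variable (R M) [AddCommGroup M] [Module R M]

/-- The canonical presentation of `M` by generators `(m, i)`. -/
noncomputable def genMap : GenModule R M →ₗ[R] M := (genBasis R M).constr R Prod.fst

theorem genMap_genBasis (q : M × ℕ) : genMap R M (genBasis R M q) = q.1 := by
  simp [genMap]

/-- Finitely many of the generators `(m, i)` of `M` and a finitely generated module of relations
between them, such that the quotient is free. -/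
structure FreePresentation : Type u where
  gens : Finset (M × ℕ)
  rels : Submodule R (GenModule R M)
  fg : rels.FG
  le_span : rels ≤ genSpan R gens
  le_ker : rels ≤ LinearMap.ker (genMap R M)
  free : Module.Free R (genSpan R gens ⧸ rels.comap (genSpan R gens).subtype)

variable {R M}

namespace FreePresentation

instance : Preorder (FreePresentation R M) where
  le i j := i.gens ⊆ j.gens ∧ i.rels ≤ j.rels
  le_refl i := ⟨subset_rfl, le_rfl⟩
  le_trans _ _ _ h h' := ⟨h.1.trans h'.1, h.2.trans h'.2⟩

/-- The submodule spanned by the generators. -/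
noncomputable abbrev span (i : FreePresentation R M) : Submodule R (GenModule R M) := genSpan R i.gens

/-- The module presented by `i`. -/
noncomputable abbrev quot (i : FreePresentation R M) : Type u := i.span ⧸ i.rels.comap i.span.subtype

theorem span_mono {i j : FreePresentation R M} (h : i ≤ j) : i.span ≤ j.span :=
  genSpan_mono h.1

/-- The transition maps. -/
noncomputable def map (i j : FreePresentation R M) (h : i ≤ j) : i.quot →ₗ[R] j.quot :=
  Submodule.mapQ _ _ (Submodule.inclusion (span_mono h)) fun _ hz => h.2 hz

theorem map_mk (i j : FreePresentation R M) (h : i ≤ j) (z : i.span) :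
    map i j h (Submodule.Quotient.mk z) =
      Submodule.Quotient.mk (Submodule.inclusion (span_mono h) z) := rfl

instance directedSystem : DirectedSystem (quot (R := R) (M := M)) (fun i j h => map i j h) where
  map_self i x := by
    obtain ⟨x, rfl⟩ := Submodule.Quotient.mk_surjective _ x
    rfl
  map_map i j k hij hjk x := by
    obtain ⟨x, rfl⟩ := Submodule.Quotient.mk_surjective _ x
    rfl

/-- The map from the presented module to `M`. -/
noncomputable def toModule (i : FreePresentation R M) : i.quot →ₗ[R] M :=
  Submodule.liftQ _ (genMap R M ∘ₗ i.span.subtype) fun _ hz => i.le_ker hz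

theorem toModule_mk (i : FreePresentation R M) (z : i.span) :
    i.toModule (Submodule.Quotient.mk z) = genMap R M z := rfl

/-- Flatness factors ⟨I⟩ → M, which kills K, through some Rᵏ with K still killed. The k basis
vectors are added as new generators, and the new relations are the kernel of the resulting
surjection onto Rᵏ, so the quotient is free. -/
theorem exists_le [Module.Flat R M] (I : Finset (M × ℕ)) (K : Submodule R (GenModule R M))
    (hK : K.FG) (hKI : K ≤ genSpan R I) (hKM : K ≤ LinearMap.ker (genMap R M)) :
    ∃ i : FreePresentation R M, I ⊆ i.gens ∧ K ≤ i.rels := by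
  classical
  have : Module.Finite R K := .of_fg hK
  obtain ⟨k, a, y, hay, haK⟩ := Module.Flat.exists_factorization_of_comp_eq_zero_of_free
    (f := Submodule.inclusion hKI) (x := genMap R M ∘ₗ Submodule.subtype _)
    (LinearMap.ext fun z => hKM z.2)
  -- Each m occurs as infinitely many generators (m, i). Indices above the bound B make the new
  -- generators distinct from each other and from those in I.
  obtain ⟨B, hB⟩ := (I.image Prod.snd).bddAbove
  let p : Fin k → M × ℕ := fun j => (y (Finsupp.single j 1), B + 1 + j)
  have hp : Function.Injective p := fun j l h => by
    have := congrArg Prod.snd h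
    simp only [p] at this
    exact Fin.ext (by omega)
  have hpI : ∀ q ∈ I, ¬∃ j, p j = q := by
    rintro _ hq ⟨j, rfl⟩
    have : B + 1 + j ≤ B := hB (Finset.mem_coe.2 (Finset.mem_image_of_mem Prod.snd hq))
    omega
  -- θ extends the factorization map `a` on I and sends the j-th new generator to the j-th basis
  -- vector.
  let θ : GenModule R M →ₗ[R] (Fin k →₀ R) := (genBasis R M).constr R
    (Function.extend p (fun j => Finsupp.single j 1)
      (fun q => if hq : q ∈ I then a ⟨genBasis R M q, genBasis_mem hq⟩ else 0))
  have hθp : ∀ j, θ (genBasis R M (p j)) = Finsupp.single j 1 := fun j => by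
    simp [θ, hp.extend_apply]
  have hθI : θ ∘ₗ (genSpan R I).subtype = a := eq_on_genSpan fun q hq => by
    simp [θ, Function.extend_apply' _ _ _ (hpI q hq), hq]
  let J : Finset (M × ℕ) := I ∪ Finset.univ.image p
  let P := genSpan R J
  have hIP : genSpan R I ≤ P := genSpan_mono Finset.subset_union_left
  have hpJ : ∀ j, p j ∈ J := fun j =>
    Finset.mem_union_right _ (Finset.mem_image_of_mem p (Finset.mem_univ j))
  have hsurj : Function.Surjective (θ ∘ₗ P.subtype) := by
    rw [← LinearMap.range_eq_top, eq_top_iff, ← Finsupp.basisSingleOne.span_eq, Submodule.span_le]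
    rintro _ ⟨j, rfl⟩
    exact ⟨⟨_, genBasis_mem (hpJ j)⟩, by simpa using hθp j⟩
  have hker : (P ⊓ LinearMap.ker θ).comap P.subtype = LinearMap.ker (θ ∘ₗ P.subtype) := by
    rw [Submodule.comap_inf, LinearMap.ker_comp, Submodule.comap_subtype_self, top_inf_eq]
  have hyθ : genMap R M ∘ₗ P.subtype = y ∘ₗ θ ∘ₗ P.subtype := by
    refine eq_on_genSpan fun q hq => ?_
    rcases Finset.mem_union.1 hq with hq | hq
    · have h₁ := LinearMap.congr_fun hay ⟨genBasis R M q, genBasis_mem hq⟩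
      rw [← hθI] at h₁
      exact h₁
    · obtain ⟨j, -, rfl⟩ := Finset.mem_image.1 hq
      change genMap R M (genBasis R M (p j)) = y (θ (genBasis R M (p j)))
      rw [hθp, genMap_genBasis]
  refine ⟨⟨J, P ⊓ LinearMap.ker θ, ?_, inf_le_left, ?_, ?_⟩, Finset.subset_union_left, ?_⟩
  · have h := (Module.FinitePresentation.fg_ker _ hsurj).map P.subtype
    rwa [← hker, Submodule.map_comap_subtype, ← inf_assoc, inf_idem] at h
  · rintro z ⟨hz, hz'⟩
    have h₁ : genMap R M z = y (θ z) := LinearMap.congr_fun hyθ ⟨z, hz⟩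
    rw [LinearMap.mem_ker, h₁, LinearMap.mem_ker.1 hz', _root_.map_zero]
  · change Module.Free R (P ⧸ (P ⊓ LinearMap.ker θ).comap P.subtype)
    rw [hker]
    exact Module.Free.of_equiv (LinearMap.quotKerEquivOfSurjective _ hsurj).symm
  · intro z hz
    refine ⟨hIP (hKI hz), ?_⟩
    have h₁ : θ z = a ⟨z, hKI hz⟩ := LinearMap.congr_fun hθI ⟨z, hKI hz⟩
    exact h₁.trans (LinearMap.congr_fun haK ⟨z, hz⟩)

theorem isDirectedOrder [Module.Flat R M] : IsDirectedOrder (FreePresentation R M) := by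
  classical
  refine ⟨fun i j => ?_⟩
  obtain ⟨k, h₁, h₂⟩ := exists_le (i.gens ∪ j.gens) (i.rels ⊔ j.rels) (i.fg.sup j.fg)
    (sup_le (i.le_span.trans (genSpan_mono Finset.subset_union_left))
      (j.le_span.trans (genSpan_mono Finset.subset_union_right)))
    (sup_le i.le_ker j.le_ker)
  exact ⟨k, ⟨Finset.subset_union_left.trans h₁, le_sup_left.trans h₂⟩,
    ⟨Finset.subset_union_right.trans h₁, le_sup_right.trans h₂⟩⟩

theorem nonempty [Module.Flat R M] : Nonempty (FreePresentation R M) :=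
  let ⟨i, _⟩ := exists_le (R := R) (M := M) ∅ ⊥ Submodule.fg_bot bot_le bot_le
  ⟨i⟩

theorem exists_toModule_eq [Module.Flat R M] (m : M) :
    ∃ (i : FreePresentation R M) (x : i.quot), i.toModule x = m := by
  obtain ⟨i, hi, -⟩ := exists_le (R := R) {(m, 0)} ⊥ Submodule.fg_bot bot_le bot_le
  refine ⟨i, Submodule.Quotient.mk ⟨genBasis R M (m, 0),
    genBasis_mem (hi (Finset.mem_singleton_self _))⟩, ?_⟩
  rw [toModule_mk, genMap_genBasis]

/-- A representative of x is adjoined to the relations, and the enlarged presentation is then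
dominated by a free one. -/
theorem exists_map_eq_zero [Module.Flat R M] (i : FreePresentation R M) (x : i.quot)
    (hx : i.toModule x = 0) : ∃ (j : FreePresentation R M) (h : i ≤ j), map i j h x = 0 := by
  obtain ⟨z, rfl⟩ := Submodule.Quotient.mk_surjective _ x
  obtain ⟨j, h₁, h₂⟩ := exists_le i.gens (i.rels ⊔ Submodule.span R {z.1})
    (i.fg.sup (Submodule.fg_span_singleton _))
    (sup_le i.le_span ((Submodule.span_singleton_le_iff_mem _ _).2 z.2))
    (sup_le i.le_ker ((Submodule.span_singleton_le_iff_mem _ _).2 hx))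
  refine ⟨j, ⟨h₁, le_sup_left.trans h₂⟩, ?_⟩
  rw [map_mk, Submodule.Quotient.mk_eq_zero]
  exact h₂ (Submodule.mem_sup_right (Submodule.mem_span_singleton_self _))

theorem toModule_map (i j : FreePresentation R M) (h : i ≤ j) (x : i.quot) :
    j.toModule (map i j h x) = i.toModule x := by
  obtain ⟨z, rfl⟩ := Submodule.Quotient.mk_surjective _ x
  rfl

theorem bijective_lift [Module.Flat R M] [DecidableEq (FreePresentation R M)] :
    Function.Bijective (Module.DirectLimit.lift R (FreePresentation R M) quot map toModule
      toModule_map) := by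
  have := isDirectedOrder (R := R) (M := M)
  have := nonempty (R := R) (M := M)
  constructor
  · rw [injective_iff_map_eq_zero]
    intro z hz
    obtain ⟨i, x, rfl⟩ := Module.DirectLimit.exists_of z
    rw [Module.DirectLimit.lift_of] at hz
    obtain ⟨j, h, hj⟩ := exists_map_eq_zero i x hz
    rw [← Module.DirectLimit.of_f (hij := h), hj, _root_.map_zero]
  · intro m
    obtain ⟨i, x, rfl⟩ := exists_toModule_eq (R := R) m
    exact ⟨Module.DirectLimit.of R _ _ _ i x, Module.DirectLimit.lift_of ..⟩

end FreePresentation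

end Lazard

namespace ModuleFunctor

/-! ### Flat Mittag-Leffler modules -/

section MittagLeffler

variable {R : Type u} [CommRing R] {M : Type u} [AddCommGroup M] [Module R M]

/-- On a finite free module the coordinate forms alone detect the vanishing of a tensor. -/
theorem sum_tmul_eq_zero_of_forall_dual {L : Type u} [AddCommGroup L] [Module R L]
    [Module.Free R L] [Module.Finite R L] {S : Type u} [CommRing S] [Algebra R S] {n : ℕ}
    (s : Fin n → S) (l : Fin n → L) (h : ∀ φ : Module.Dual R L, ∑ a, φ (l a) • s a = 0) :
    ∑ a, s a ⊗ₜ[R] l a = 0 := by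
  let b := Module.Free.chooseBasis R L
  have hl : ∀ a, s a ⊗ₜ[R] l a = ∑ i, (b.coord i (l a) • s a) ⊗ₜ[R] b i := by
    intro a
    conv_lhs => rw [← b.sum_repr (l a), TensorProduct.tmul_sum]
    simp only [TensorProduct.tmul_smul, TensorProduct.smul_tmul', Module.Basis.coord_apply]
  simp_rw [hl]
  rw [Finset.sum_comm]
  refine Finset.sum_eq_zero fun i _ => ?_
  rw [← TensorProduct.sum_tmul, h, TensorProduct.zero_tmul]

/-- Lift the xₐ to lₐ in some Lᵢ. A point s is in the kernel iff ∑ sₐ ⊗ lₐ dies in some S ⊗ Lₖ, and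
there it is tested by forms on Lₖ pulled back to Lᵢ. By Mittag-Leffler these pullbacks do not depend
on k once k ≥ j, so one fixed set of linear equations works for all S. -/
theorem ker_powHom_of_isFlatMittagLeffler (h : IsFlatMittagLeffler R M) {n : ℕ} (x : Fin n → M) :
    (powHom (R := R) x).ker.toFunctor.IsAssociatedScheme := by
  obtain ⟨ι, _, _, _, _, L, _, _, t, _, hL, hML, ⟨e⟩⟩ := h
  have hx : ∀ a, ∃ i, ∃ l : L i, Module.DirectLimit.of R ι L t i l = e.symm (x a) := fun a =>
    Module.DirectLimit.exists_of (e.symm (x a))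
  choose i' l' hl' using hx
  obtain ⟨i, hi⟩ := Finite.exists_le i'
  let l : Fin n → L i := fun a => t _ _ (hi a) (l' a)
  have hl : ∀ a, e (Module.DirectLimit.of R ι L t i (l a)) = x a := fun a => by
    rw [Module.DirectLimit.of_f, hl', LinearEquiv.apply_symm_apply]
  obtain ⟨j, hij, hj⟩ := hML i
  refine Sub.isAssociatedScheme_of_mem_iff (powToHomFunctor R n) (isIso_powToHomFunctor n) _
    ((LinearMap.range (t i j hij).dualMap).map
      (LinearMap.pi fun a => Module.Dual.eval R (L i) (l a))) fun S _ _ s => ?_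
  change (powHom x).app S s = 0 ↔ _
  rw [powHom_apply]
  constructor
  · rintro h₁ _ ⟨ψ, hψ, rfl⟩
    have h₂ : ∑ a, s a ⊗ₜ[R] Module.DirectLimit.of R ι L t i (l a) = 0 := by
      have := congrArg (TensorProduct.map (LinearMap.id : S →ₗ[R] S) e.symm.toLinearMap) h₁
      simpa [← hl] using this
    have h₃ := congrArg (TensorProduct.directLimitRight t S) h₂
    rw [map_sum, _root_.map_zero] at h₃
    simp only [TensorProduct.directLimitRight_tmul_of] at h₃
    rw [← map_sum] at h₃
    obtain ⟨k, hik, h₄⟩ := Module.DirectLimit.of.zero_exact h₃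
    -- The stage where the tensor dies depends on s. Moving beyond j allows the form ψ to be
    -- replaced by a pullback from L k'.
    obtain ⟨k', hkk', hjk'⟩ := exists_ge_ge k j
    rw [SetLike.mem_coe, ← hj k' hjk'] at hψ
    obtain ⟨φ, rfl⟩ := hψ
    have h₅ := congrArg (fun z => TensorProduct.rid R S
      (TensorProduct.map (LinearMap.id : S →ₗ[R] S) (φ ∘ₗ t k k' hkk') z)) h₄
    rw [powToHomFunctor_apply]
    have h₆ : ∀ a, t k k' hkk' (t i k hik (l a)) = t i k' (hij.trans hjk') (l a) := fun a =>
      DirectedSystem.map_map' (f := fun i j h => t i j h) hik hkk' (l a)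
    simpa [h₆] using h₅
  · intro h₁
    have h₂ : ∑ a, s a ⊗ₜ[R] t i j hij (l a) = 0 := by
      have := (hL j).1
      have := (hL j).2
      refine sum_tmul_eq_zero_of_forall_dual s _ fun φ => ?_
      have := h₁ _ ⟨_, ⟨φ, rfl⟩, rfl⟩
      rw [powToHomFunctor_apply] at this
      exact this
    have h₃ := congrArg (TensorProduct.map (LinearMap.id : S →ₗ[R] S)
      (e.toLinearMap ∘ₗ Module.DirectLimit.of R ι L t j)) h₂
    simpa [hl] using h₃

/-- A basis of Lᵢ identifies Lᵢ^* with Rⁿ. Let N be the coefficient module of the image of this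
basis in M. Minimality puts N inside the image of every Lₖ^*, and for a suitable j the image of Lⱼ^*
lies in N because the transition map factors through an expression with coefficients in N. The
images are therefore stable from j on. -/
theorem isFlatMittagLeffler_of_directedSystem {ι : Type u} [Preorder ι] [Nonempty ι]
    [IsDirectedOrder ι] [DecidableEq ι] (L : ι → Type u) [∀ i, AddCommGroup (L i)]
    [∀ i, Module R (L i)] (t : ∀ i j, i ≤ j → L i →ₗ[R] L j)
    [hsys : DirectedSystem L (fun i j h => t i j h)] [∀ i, Module.Free R (L i)]
    [∀ i, Module.Finite R (L i)] (e : Module.DirectLimit L t ≃ₗ[R] M)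
    (h : ∀ (n : ℕ) (x : Fin n → M), ∃ N : Submodule R (Fin n → R), IsCoeffModule N x) :
    IsFlatMittagLeffler R M := by
  refine ⟨ι, inferInstance, inferInstance, inferInstance, inferInstance, L, inferInstance,
    inferInstance, t, hsys, fun i => ⟨inferInstance, inferInstance⟩, fun i => ?_, ⟨e⟩⟩
  let π : ∀ i, L i →ₗ[R] M := fun i => e.toLinearMap ∘ₗ Module.DirectLimit.of R ι L t i
  have hπt : ∀ i j h x, π j (t i j h x) = π i x := fun i j h x =>
    congrArg e Module.DirectLimit.of_f
  have htt : ∀ i j k hij hjk x, t j k hjk (t i j hij x) = t i k (hij.trans hjk) x :=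
    fun i j k hij hjk x => DirectedSystem.map_map' (f := fun i j h => t i j h) hij hjk x
  have hπ : ∀ m, ∃ i y, π i y = m := fun m => by
    obtain ⟨i, y, hy⟩ := Module.DirectLimit.exists_of (e.symm m)
    exact ⟨i, y, by simp [π, hy]⟩
  let b₀ := Module.Free.chooseBasis R (L i)
  let b := b₀.reindex (Fintype.equivFin _)
  obtain ⟨N, hN⟩ := h _ (fun a => π i (b a))
  obtain ⟨k, c, y, hc, hx⟩ := hN.coeffIn
  replace hx : ∀ a, π i (b a) = ∑ j, c j a • y j := hx
  -- α records the coefficients cⱼ of the basis and β lifts the yⱼ, so β ∘ α agrees with the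
  -- transition maps after passing to M.
  let α : L i →ₗ[R] (Fin k → R) := b.constr R fun a j => c j a
  have hα : ∀ a, α (b a) = fun j => c j a := fun a => by simp [α]
  choose i' l' hl' using fun j => hπ (y j)
  obtain ⟨i₀, hi₀⟩ := Finite.exists_le i'
  let β : (Fin k → R) →ₗ[R] L i₀ :=
    Fintype.linearCombination R fun j => t _ _ (hi₀ j) (l' j)
  have hβ : ∀ a, π i₀ (β (α (b a))) = π i (b a) := fun a => by
    rw [hx, hα, Fintype.linearCombination_apply, map_sum]
    refine Finset.sum_congr rfl fun j _ => ?_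
    rw [_root_.map_smul, hπt, hl']
  obtain ⟨i₁, hi₁, hi₀₁⟩ := exists_ge_ge i i₀
  have hex : ∀ a, ∃ j, ∃ h : i₁ ≤ j, t i₁ j h (t i i₁ hi₁ (b a)) =
      t i₁ j h (t i₀ i₁ hi₀₁ (β (α (b a)))) := fun a => by
    have : π i₁ (t i i₁ hi₁ (b a)) = π i₁ (t i₀ i₁ hi₀₁ (β (α (b a)))) := by
      rw [hπt, hπt, hβ]
    exact Module.DirectLimit.exists_eq_of_of_eq (e.injective this)
  choose j' hj' hjj' using hex
  obtain ⟨j₀, hj₀⟩ := Finite.exists_le j'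
  obtain ⟨j, hj₀j, hi₁j⟩ := exists_ge_ge j₀ i₁
  -- The agreement in M holds on finitely many basis vectors, hence already at a finite stage j.
  have ht : t i j (hi₁.trans hi₁j) = t i₀ j (hi₀₁.trans hi₁j) ∘ₗ β ∘ₗ α := by
    refine b.ext fun a => ?_
    have := congrArg (t (j' a) j ((hj₀ a).trans hj₀j)) (hjj' a)
    rw [htt, htt, htt, htt] at this
    exact this
  refine ⟨j, hi₁.trans hi₁j, fun k' hjk' => le_antisymm ?_ ?_⟩
  · rintro _ ⟨φ, rfl⟩
    refine ⟨φ ∘ₗ t j k' hjk', LinearMap.ext fun z => ?_⟩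
    change φ (t j k' hjk' (t i j _ z)) = φ (t i k' _ z)
    rw [htt]
  · rintro _ ⟨φ, rfl⟩
    let Q := (LinearMap.range (t i k' ((hi₁.trans hi₁j).trans hjk')).dualMap).map
      (LinearMap.pi fun a => Module.Dual.eval R (L i) (b a))
    -- A basis of L k' writes the images of the b a in M with coefficients pulled back from (L
    -- k')^*.
    have hNQ : N ≤ Q := by
      let b' := (Module.Free.chooseBasis R (L k')).reindex (Fintype.equivFin _)
      refine hN.le _ ⟨_, fun m a => b'.coord m (t i k' ((hi₁.trans hi₁j).trans hjk') (b a)),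
        fun m => π k' (b' m), fun m => ⟨_, ⟨b'.coord m, rfl⟩, rfl⟩, fun a => ?_⟩
      change π i (b a) = ∑ m, b'.coord m (t i k' _ (b a)) • π k' (b' m)
      rw [← hπt i k' ((hi₁.trans hi₁j).trans hjk') (b a)]
      conv_lhs => rw [← b'.sum_repr (t i k' ((hi₁.trans hi₁j).trans hjk') (b a)), map_sum]
      simp only [_root_.map_smul, Module.Basis.coord_apply]
    let φ' : (Fin k → R) →ₗ[R] R := φ ∘ₗ t i₀ j (hi₀₁.trans hi₁j) ∘ₗ β
    -- A form pulled back from L j factors through α, so its coordinate vector is a combination of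
    -- the cⱼ in N.
    have hmem : (fun a => (t i j (hi₁.trans hi₁j)).dualMap φ (b a)) ∈ N := by
      have h₁ : (fun a => (t i j (hi₁.trans hi₁j)).dualMap φ (b a)) =
          ∑ j, φ' (Pi.single j 1) • c j := by
        funext a
        rw [LinearMap.dualMap_apply, ht]
        change φ' (α (b a)) = _
        rw [hα, pi_eq_sum_univ' (fun j => c j a), map_sum, Finset.sum_apply]
        refine Finset.sum_congr rfl fun j _ => ?_
        rw [_root_.map_smul, Pi.smul_apply, smul_eq_mul, smul_eq_mul, mul_comm]
      rw [h₁]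
      exact sum_mem fun j _ => Submodule.smul_mem _ _ (hc j)
    obtain ⟨χ, hχ, hχ'⟩ := hNQ hmem
    have : χ = (t i j (hi₁.trans hi₁j)).dualMap φ := b.ext fun a => congrFun hχ' a
    rw [← this]
    exact hχ

theorem isFlatMittagLeffler_of_forall_ker (h : ∀ (n : ℕ) (x : Fin n → M),
    (powHom (R := R) x).ker.toFunctor.IsAssociatedScheme) : IsFlatMittagLeffler R M := by
  classical
  have := flat_of_forall_ker h
  have := FreePresentation.nonempty (R := R) (M := M)
  have := FreePresentation.isDirectedOrder (R := R) (M := M)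
  have : ∀ i : FreePresentation R M, Module.Free R i.quot := fun i => i.free
  exact isFlatMittagLeffler_of_directedSystem FreePresentation.quot FreePresentation.map
    (LinearEquiv.ofBijective _ FreePresentation.bijective_lift)
    fun n x => exists_isCoeffModule x (h n x)

end MittagLeffler

/-! ### The characterizations -/

section

variable {R : Type u} [CommRing R] {M : Type u} [AddCommGroup M] [Module R M]

theorem forall_ker_iff_forall_ker_powHom :
    (∀ (n : ℕ) (f : Hom (ringPow R n) (quasiCoherent R M)), f.ker.toFunctor.IsAssociatedScheme) ↔
      ∀ (n : ℕ) (x : Fin n → M), (powHom (R := R) x).ker.toFunctor.IsAssociatedScheme := by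
  refine ⟨fun h n x => h n _, fun h n f => ?_⟩
  obtain ⟨x, hx⟩ := f.exists_eq_sum_tmul
  have : f.ker = (powHom x).ker := by
    apply Sub.ext
    funext S _ _
    ext s
    change f.app S s = 0 ↔ (powHom x).app S s = 0
    rw [hx, powHom_apply]
  rw [this]
  exact h n x

/-- Every finite family of elements of `M` lies in a submodule scheme of `𝓜`. -/
def HasSubschemes (R : Type u) [CommRing R] (M : Type u) [AddCommGroup M] [Module R M] : Prop :=
  ∀ (n : ℕ) (x : Fin n → M), ∃ W : Sub (quasiCoherent R M), W.toFunctor.IsAssociatedScheme ∧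
    ∀ a, (1 : R) ⊗ₜ[R] x a ∈ W.carrier R

theorem hasSubschemes_iff_factorsThrough : HasSubschemes R M ↔
    ∀ (n : ℕ) (f : Hom (ringPow R n) (quasiCoherent R M)), ∃ W : Sub (quasiCoherent R M),
      W.toFunctor.IsAssociatedScheme ∧ f.FactorsThrough W := by
  constructor
  · intro h n f
    obtain ⟨x, hx⟩ := f.exists_eq_sum_tmul
    obtain ⟨W, hW, hxW⟩ := h n x
    exact ⟨W, hW, (factorsThrough_iff_tmul_mem hx).2 hxW⟩
  · intro h n x
    obtain ⟨W, hW, hf⟩ := h n (powHom x)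
    exact ⟨W, hW, (factorsThrough_iff_tmul_mem fun S _ _ s => powHom_apply x s).1 hf⟩

/-- One argument serves all classes between the associated schemes and the affine ones; the tangent
space bounds an affine submodule by the image of a module scheme. -/
theorem isDirectLimitOfAllSubs_of_hasSubschemes (h : HasSubschemes R M)
    (P : Sub (quasiCoherent R M) → Prop)
    (hP : ∀ W : Sub (quasiCoherent R M), W.toFunctor.IsAssociatedScheme → P W)
    (hP' : ∀ W, P W → W.toFunctor.IsAffineScheme) :
    (quasiCoherent R M).IsDirectLimitOfAllSubs P := by
  refine isDirectLimitOfSubs_quasiCoherent _ _ (fun _ _ h => h) (fun n x => ?_) fun i => ?_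
  · obtain ⟨W, hW, hx⟩ := h n x
    exact ⟨⟨W, hP W hW⟩, hx⟩
  · obtain ⟨N, _, _, f, hf⟩ := (Sub.isAssociatedScheme_tangent
      (isTangentSelf_quasiCoherent M) (hP' _ i.2)).exists_le_range
    exact ⟨N, _, _, f, le_trans i.1.le_tangent hf⟩

/-- An affine member containing the family is enlarged to its tangent space, which is a module
scheme. -/
theorem hasSubschemes_of_isDirectLimitOfSubs {ι : Type w₃} [Preorder ι]
    {W : ι → Sub (quasiCoherent R M)} {hW : Monotone W}
    (h : (quasiCoherent R M).IsDirectLimitOfSubs W hW)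
    (hA : ∀ i, (W i).toFunctor.IsAffineScheme) : HasSubschemes R M := by
  intro n x
  obtain ⟨i, hi⟩ := h.exists_tmul_mem x
  exact ⟨(W i).tangent, Sub.isAssociatedScheme_tangent (isTangentSelf_quasiCoherent M) (hA i),
    fun a => (W i).le_tangent R (hi a)⟩

theorem hasSubschemes_of_factorsThrough_schemeOf
    (h : ∀ (N : Type u) [AddCommGroup N] [Module R N]
      (f : Hom (schemeOf R N) (quasiCoherent R M)), ∃ W : Sub (quasiCoherent R M),
        W.toFunctor.IsAssociatedScheme ∧ f.FactorsThrough W) : HasSubschemes R M := by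
  intro n x
  let ε := schemeOfToHomFunctor (R := R) (Fin n → R)
  have hε : ε.IsIso := isIso_schemeOfToHomFunctor _
  let g := tensorHom (R := R) (fun a => Pi.single a (1 : R)) x
  obtain ⟨W, hW, hf⟩ := h _ (g.comp ε)
  refine ⟨W, hW, (factorsThrough_iff_tmul_mem (fun S _ _ s => powHom_apply x s)).1 ?_⟩
  rw [Hom.factorsThrough_iff] at hf ⊢
  intro S _ _ s
  have := hf S ((ε.inv hε).app S ((powToHomFunctor R n).app S s))
  rw [Hom.comp_app, Hom.app_inv] at this
  exact this

theorem factorsThrough_schemeOf_of_hasSubschemes (h : HasSubschemes R M)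
    (N : Type u) [AddCommGroup N] [Module R N] (f : Hom (schemeOf R N) (quasiCoherent R M)) :
    ∃ W : Sub (quasiCoherent R M), W.toFunctor.IsAssociatedScheme ∧ f.FactorsThrough W := by
  let ε := schemeOfToHomFunctor (R := R) N
  have hε : ε.IsIso := isIso_schemeOfToHomFunctor _
  obtain ⟨k, n, m, hf⟩ := (f.comp (ε.inv hε)).exists_sum
  obtain ⟨W, hW, hm⟩ := h k m
  refine ⟨W, hW, Hom.factorsThrough_iff.2 fun S _ _ y => ?_⟩
  have := hf S (ε.app S y)
  rw [Hom.comp_app, Hom.inv_app] at this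
  rw [this]
  exact sum_mem fun a _ => Sub.tmul_mem (hm a) _

theorem forall_ker_of_hasSubschemes (h : HasSubschemes R M) {n : ℕ} (x : Fin n → M) :
    (powHom (R := R) x).ker.toFunctor.IsAssociatedScheme := by
  obtain ⟨W, hW, hx⟩ := h n x
  exact (powHom x).ker_isAssociatedScheme_of_factorsThrough hW
    ((factorsThrough_iff_tmul_mem fun S _ _ s => powHom_apply x s).2 hx)

theorem ker_schemeOf_of_forall_ker (h : ∀ (n : ℕ) (x : Fin n → M),
    (powHom (R := R) x).ker.toFunctor.IsAssociatedScheme)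
    (N : Type u) [AddCommGroup N] [Module R N] (f : Hom (schemeOf R N) (quasiCoherent R M)) :
    f.ker.toFunctor.IsAssociatedScheme := by
  let ε := schemeOfToHomFunctor (R := R) N
  have hε : ε.IsIso := isIso_schemeOfToHomFunctor _
  have := ker_tensorHom_isAssociatedScheme h ε hε (f.comp (ε.inv hε))
  have e : ((f.comp (ε.inv hε)).comp ε).ker = f.ker := by
    apply Sub.ext
    funext S _ _
    ext s
    change f.app S ((ε.inv hε).app S (ε.app S s)) = 0 ↔ f.app S s = 0
    rw [Hom.inv_app]
  rwa [e] at this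

theorem ker_powHom_of_forall_ker_schemeOf
    (h : ∀ (N : Type u) [AddCommGroup N] [Module R N]
      (f : Hom (schemeOf R N) (quasiCoherent R M)), f.ker.toFunctor.IsAssociatedScheme)
    {n : ℕ} (x : Fin n → M) : (powHom (R := R) x).ker.toFunctor.IsAssociatedScheme := by
  let ε := schemeOfToHomFunctor (R := R) (Fin n → R)
  have hε : ε.IsIso := isIso_schemeOfToHomFunctor _
  let ρ := (powToHomFunctor R n).inv (isIso_powToHomFunctor n)
  have hρ : (ρ.comp ε).IsIso := (Hom.isIso_inv _ _).comp hε
  let f := (powHom (R := R) x).comp (ρ.comp ε)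
  let d : Hom f.ker.toFunctor (powHom (R := R) x).ker.toFunctor :=
    { app := fun S _ _ => ((ρ.comp ε).app S).restrict fun _ hy => hy
      naturality := fun g y => Subtype.ext ((ρ.comp ε).naturality g y.1) }
  refine (h _ f).of_isIso d fun S _ _ => ⟨fun y z hyz => ?_, fun y => ?_⟩
  · exact Subtype.ext ((hρ S).1 (congrArg Subtype.val hyz))
  · obtain ⟨z, hz⟩ := (hρ S).2 y.1
    refine ⟨⟨z, ?_⟩, Subtype.ext hz⟩
    change (powHom x).app S ((ρ.comp ε).app S z) = 0
    rw [hz]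
    exact y.2

theorem hasSubschemes_of_isDirectLimit {ι : Type w₃} [Preorder ι] {N : ι → Type u}
    [∀ i, AddCommGroup (N i)] [∀ i, Module R (N i)]
    {t : ∀ i j, i ≤ j → Hom (schemeOf R (N i)) (schemeOf R (N j))}
    {c : ∀ i, Hom (schemeOf R (N i)) (quasiCoherent R M)}
    (h : IsDirectLimit (fun i => schemeOf R (N i)) t (quasiCoherent R M) c)
    (ht : ∀ i j h, (t i j h).IsMono) : HasSubschemes R M := by
  intro n x
  obtain ⟨i, hi⟩ := h.exists_tmul_mem_range x
  exact ⟨(c i).range, (h.isMono ht i).isAssociatedScheme_range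
    ⟨N i, _, _, ⟨fun _ _ _ => LinearMap.id, fun _ _ => rfl⟩, fun _ _ _ => Function.bijective_id⟩,
    hi⟩

/-- `SubschemeData` lives in `Type u`, so it provides the small index set required of a directed
family, unlike the collection of all submodules. -/
theorem isDirectLimitOfSubs_subschemeData (h : ∀ (n : ℕ) (x : Fin n → M),
    (powHom (R := R) x).ker.toFunctor.IsAssociatedScheme) :
    (quasiCoherent R M).IsDirectLimitOfSubs (SubschemeData.sub (R := R) (M := M))
      (fun _ _ h => h) :=
  isDirectLimitOfSubs_quasiCoherent _ _ (fun _ _ h => h) (fun _ x => exists_subschemeData h x)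
    fun D => D.isAssociatedScheme.exists_le_range

theorem exists_isDirectLimit_schemeOf {ι : Type w₃} [Preorder ι]
    {W : ι → Sub (quasiCoherent R M)} {hW : Monotone W}
    (hA : ∀ i, (W i).toFunctor.IsAssociatedScheme)
    (h : (quasiCoherent R M).IsDirectLimitOfSubs W hW) :
    ∃ (N : ι → Type u) (_ : ∀ i, AddCommGroup (N i)) (_ : ∀ i, Module R (N i))
      (t : ∀ i j, i ≤ j → Hom (schemeOf R (N i)) (schemeOf R (N j)))
      (c : ∀ i, Hom (schemeOf R (N i)) (quasiCoherent R M)),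
      (∀ i j h, (t i j h).IsMono) ∧
        IsDirectLimit (fun i => schemeOf R (N i)) t (quasiCoherent R M) c := by
  choose N iN mN e he using hA
  have hc : ∀ (S : Type u) [CommRing S] [Algebra R S] (i j : ι) (hij : i ≤ j)
      (x : (schemeOf R (N i)).obj S), (e j).app S (((e j).inv (he j)).app S
        ((Sub.inclusion (hW hij)).app S ((e i).app S x))) =
        (Sub.inclusion (hW hij)).app S ((e i).app S x) := fun S _ _ i j hij x => by
    rw [Hom.app_inv]
  refine ⟨N, iN, mN, fun i j hij => ((e j).inv (he j)).comp ((Sub.inclusion (hW hij)).comp (e i)),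
    fun i => (W i).incl.comp (e i), fun i j hij S _ _ => ?_, h.nonempty, h.directed,
    fun S _ _ => ⟨fun i x => ?_, fun i j k hij hjk x => ?_⟩, fun S _ _ i j hij x => ?_,
    fun S _ _ _ => ⟨?_, fun z => ?_⟩⟩
  · exact ((e j).isIso_inv (he j) S).1.comp ((Submodule.inclusion_injective (hW hij S)).comp (he i S).1)
  · exact Hom.inv_app (e i) (he i) S x
  · apply (he _ S).1
    refine (hc S _ _ hjk _).trans ?_
    refine Eq.trans ?_ (hc S _ _ (hij.trans hjk) _).symm
    exact congrArg _ (hc S _ _ hij x)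
  · exact congrArg Subtype.val (hc S i j hij x)
  · have := h.directed
    exact Module.DirectLimit.lift_injective _ _ fun i => Subtype.val_injective.comp (he i S).1
  · have := h.nonempty
    have := h.directed
    obtain ⟨z, rfl⟩ := (h.bijective S).2 z
    obtain ⟨i, y, rfl⟩ := Module.DirectLimit.exists_of z
    obtain ⟨x, rfl⟩ := (he i S).2 y
    refine ⟨Module.DirectLimit.of S ι (fun i => (schemeOf R (N i)).obj S) _ i x, ?_⟩
    refine (Module.DirectLimit.lift_of ..).trans ?_
    exact (Module.DirectLimit.lift_of (G := fun i => (W i).toFunctor.obj S)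
      (f := fun i j hij => (Sub.inclusion (hW hij)).app S) (fun i => (W i).incl.app S)
      (h.compatible S) ((e i).app S x)).symm

end

end ModuleFunctor

theorem mainTheorem2 (R : Type u) [CommRing R] (M : Type u) [AddCommGroup M] [Module R M] :
    List.TFAE [
      -- `M` is a flat Mittag-Leffler module
      IsFlatMittagLeffler R M,
      -- `𝓜` is a direct limit of `𝓡`-submodule schemes associated with modules
      ∃ (ι : Type u) (_ : Preorder ι) (W : ι → (ModuleFunctor.quasiCoherent R M).Sub)
        (hW : Monotone W), (∀ i, (W i).toFunctor.IsAssociatedScheme) ∧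
        (ModuleFunctor.quasiCoherent R M).IsDirectLimitOfSubs W hW,
      -- `𝓜` is a direct limit of a system of schemes `𝓝ᵢ^*` whose transitions are monomorphisms
      ∃ (ι : Type u) (_ : Preorder ι) (N : ι → Type u) (_ : ∀ i, AddCommGroup (N i))
        (_ : ∀ i, Module R (N i))
        (t : ∀ i j, i ≤ j →
          ModuleFunctor.Hom (ModuleFunctor.schemeOf R (N i)) (ModuleFunctor.schemeOf R (N j)))
        (c : ∀ i, ModuleFunctor.Hom (ModuleFunctor.schemeOf R (N i))
          (ModuleFunctor.quasiCoherent R M)),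
        (∀ i j h, (t i j h).IsMono) ∧
        ModuleFunctor.IsDirectLimit (fun i => ModuleFunctor.schemeOf R (N i)) t
          (ModuleFunctor.quasiCoherent R M) c,
      -- `𝓜` is the direct limit of all its submodule schemes associated with modules
      (ModuleFunctor.quasiCoherent R M).IsDirectLimitOfAllSubs
        (fun W => W.toFunctor.IsAssociatedScheme),
      -- `𝓜` is the direct limit of all its reflexive submodule affine schemes
      (ModuleFunctor.quasiCoherent R M).IsDirectLimitOfAllSubs
        (fun W => W.toFunctor.IsReflexive ∧ W.toFunctor.IsAffineScheme),
      -- `𝓜` is the direct limit of all its submodule affine schemes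
      (ModuleFunctor.quasiCoherent R M).IsDirectLimitOfAllSubs
        (fun W => W.toFunctor.IsAffineScheme),
      -- every `𝓝^* → 𝓜` factors through a submodule scheme associated with a module
      ∀ (N : Type u) [AddCommGroup N] [Module R N]
        (f : ModuleFunctor.Hom (ModuleFunctor.schemeOf R N) (ModuleFunctor.quasiCoherent R M)),
        ∃ W : (ModuleFunctor.quasiCoherent R M).Sub,
          W.toFunctor.IsAssociatedScheme ∧ f.FactorsThrough W,
      -- every `𝓡ⁿ → 𝓜` factors through a submodule scheme associated with a module
      ∀ (n : ℕ) (f : ModuleFunctor.Hom (ModuleFunctor.ringPow R n)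
          (ModuleFunctor.quasiCoherent R M)),
        ∃ W : (ModuleFunctor.quasiCoherent R M).Sub,
          W.toFunctor.IsAssociatedScheme ∧ f.FactorsThrough W,
      -- the kernel of every `𝓝^* → 𝓜` is a module scheme associated with a module
      ∀ (N : Type u) [AddCommGroup N] [Module R N]
        (f : ModuleFunctor.Hom (ModuleFunctor.schemeOf R N) (ModuleFunctor.quasiCoherent R M)),
        f.ker.toFunctor.IsAssociatedScheme,
      -- the kernel of every `𝓡ⁿ → 𝓜` is a module scheme associated with a module
      ∀ (n : ℕ) (f : ModuleFunctor.Hom (ModuleFunctor.ringPow R n)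
          (ModuleFunctor.quasiCoherent R M)),
        f.ker.toFunctor.IsAssociatedScheme,
      -- the kernel of every `𝓝^* → 𝓜` is a reflexive module affine scheme
      ∀ (N : Type u) [AddCommGroup N] [Module R N]
        (f : ModuleFunctor.Hom (ModuleFunctor.schemeOf R N) (ModuleFunctor.quasiCoherent R M)),
        f.ker.toFunctor.IsReflexive ∧ f.ker.toFunctor.IsAffineScheme,
      -- the kernel of every `𝓡ⁿ → 𝓜` is a reflexive module affine scheme
      ∀ (n : ℕ) (f : ModuleFunctor.Hom (ModuleFunctor.ringPow R n)
          (ModuleFunctor.quasiCoherent R M)),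
        f.ker.toFunctor.IsReflexive ∧ f.ker.toFunctor.IsAffineScheme] := by
  -- Two universe instances are needed: submodules of 𝓜 and 𝓡ⁿ take values in `Type u`, those of 𝓝^*
  -- in `Type (u + 1)`.
  open ModuleFunctor in
  have hP : ∀ {F : ModuleFunctor.{u, u + 1} R}, F.IsAssociatedScheme ↔
      F.IsReflexive ∧ F.IsAffineScheme := isAssociatedScheme_iff_reflexive_affine _
  open ModuleFunctor in
  have hP' : ∀ {F : ModuleFunctor.{u, u} R}, F.IsAssociatedScheme ↔
      F.IsReflexive ∧ F.IsAffineScheme := isAssociatedScheme_iff_reflexive_affine _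
  -- This turns each reflexive affine condition into its associated scheme counterpart, so those
  -- equivalences become `Iff.rfl`.
  simp only [← hP, ← hP']
  tfae_have 1 → 10 := fun h => ModuleFunctor.forall_ker_iff_forall_ker_powHom.2 fun n x =>
    ModuleFunctor.ker_powHom_of_isFlatMittagLeffler h x
  tfae_have 10 → 1 := fun h => ModuleFunctor.isFlatMittagLeffler_of_forall_ker
    (ModuleFunctor.forall_ker_iff_forall_ker_powHom.1 h)
  tfae_have 10 → 2 := fun h => ⟨ModuleFunctor.SubschemeData R M, inferInstance,
    ModuleFunctor.SubschemeData.sub, fun _ _ h => h, fun D => D.isAssociatedScheme,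
    ModuleFunctor.isDirectLimitOfSubs_subschemeData
      (ModuleFunctor.forall_ker_iff_forall_ker_powHom.1 h)⟩
  tfae_have 2 → 3 := by
    rintro ⟨ι, _, W, hW, hA, h⟩
    obtain ⟨N, iN, mN, t, c, ht, hc⟩ := ModuleFunctor.exists_isDirectLimit_schemeOf hA h
    exact ⟨ι, _, N, iN, mN, t, c, ht, hc⟩
  tfae_have 3 → 8 := by
    rintro ⟨ι, _, N, _, _, t, c, ht, h⟩
    exact ModuleFunctor.hasSubschemes_iff_factorsThrough.1
      (ModuleFunctor.hasSubschemes_of_isDirectLimit h ht)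
  tfae_have 8 → 10 := fun h => ModuleFunctor.forall_ker_iff_forall_ker_powHom.2 fun _ x =>
    ModuleFunctor.forall_ker_of_hasSubschemes
      (ModuleFunctor.hasSubschemes_iff_factorsThrough.2 h) x
  tfae_have 8 → 4 := fun h => ModuleFunctor.isDirectLimitOfAllSubs_of_hasSubschemes
    (ModuleFunctor.hasSubschemes_iff_factorsThrough.2 h) _ (fun _ h => h)
    fun _ h => h.isAffineScheme
  tfae_have 8 → 6 := fun h => ModuleFunctor.isDirectLimitOfAllSubs_of_hasSubschemes
    (ModuleFunctor.hasSubschemes_iff_factorsThrough.2 h) _ (fun _ h => h.isAffineScheme)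
    fun _ h => h
  tfae_have 4 → 8 := fun h => ModuleFunctor.hasSubschemes_iff_factorsThrough.1
    (ModuleFunctor.hasSubschemes_of_isDirectLimitOfSubs h fun i => i.2.isAffineScheme)
  tfae_have 6 → 8 := fun h => ModuleFunctor.hasSubschemes_iff_factorsThrough.1
    (ModuleFunctor.hasSubschemes_of_isDirectLimitOfSubs h fun i => i.2)
  tfae_have 4 ↔ 5 := Iff.rfl
  tfae_have 8 → 7 := fun h N _ _ f => ModuleFunctor.factorsThrough_schemeOf_of_hasSubschemes
    (ModuleFunctor.hasSubschemes_iff_factorsThrough.2 h) N f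
  tfae_have 7 → 8 := fun h => ModuleFunctor.hasSubschemes_iff_factorsThrough.1
    (ModuleFunctor.hasSubschemes_of_factorsThrough_schemeOf h)
  tfae_have 10 → 9 := fun h N _ _ f => ModuleFunctor.ker_schemeOf_of_forall_ker
    (ModuleFunctor.forall_ker_iff_forall_ker_powHom.1 h) N f
  tfae_have 9 → 10 := fun h => ModuleFunctor.forall_ker_iff_forall_ker_powHom.2 fun _ x =>
    ModuleFunctor.ker_powHom_of_forall_ker_schemeOf h x
  tfae_have 9 ↔ 11 := Iff.rfl
  tfae_have 10 ↔ 12 := Iff.rfl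
  tfae_finish
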